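/- Let $\mathcal K$ and $\mathcal L$ be triangulated categories and let $F\colon\mathcal K\to\mathcal L$ be an exact functor with a left adjoint $V$ and a right adjoint $U$. Suppose that there is an equivalence $W\colon\mathcal L\to\mathcal L$ with $V\circ W\simeq U$. Let $\mathcal E_F$ be the class of $F$-split triangles, i.e. of distinguished triangles $X\xrightarrow{f}Y\xrightarrow{g}Z\xrightarrow{h}\Sigma X$ in $\mathcal K$ with $F(h)=0$. For a class $\mathcal E$ of distinguished triangles, the first (second) maps of triangles in $\mathcal E$ are called $\mathcal E$-monomorphisms ($\mathcal E$-epimorphisms). An object $P$ is $\mathcal E$-projective if $0\to\mathcal K(P,X)\to\mathcal K(P,Y)\to\mathcal K(P,Z)\to0$ is exact for every triangle $X\to Y\to Z\to\Sigma X$ in $\mathcal E$; $\mathcal E$-injective objects are defined dually. For $\mathcal E=\mathcal E_F$ one says $F$-projective and $F$-injective. The class $\mathcal E$ is proper if it is closed under isomorphisms, suspensions $\Sigma^n$ ($n\in\mathbb Z$), direct sums and retracts; contains $X\xrightarrow{1}X\to0\to\Sigma X$ and $0\to Y\xrightarrow{1}Y\to0$ for all $X,Y$; its monomorphisms are closed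 under homotopy pushouts and its epimorphisms under homotopy pullbacks; and a map is an $\mathcal E$-epimorphism as soon as its homotopy pullback along some $\mathcal E$-epimorphism is one. A proper class is Frobenius if every object is the target of an $\mathcal E$-epimorphism from an $\mathcal E$-projective and the source of an $\mathcal E$-monomorphism to an $\mathcal E$-injective, and the $\mathcal E$-projectives and the $\mathcal E$-injectives coincide. Then: 1. The $F$-projective and the $F$-injective objects of $\mathcal K$ coincide, and they are the objects of $\operatorname{add}(\operatorname{Im}U)=\operatorname{add}(\operatorname{Im}V)$, where $\operatorname{Im}$ is the essential image and $\operatorname{add}$ the closure under finite sums and direct summands. 2. The class $\mathcal E_F$ is proper and Frobenius. 3. The relative stable category $\mathcal K/F$, i.e. the quotient of $\mathcal K$ by the ideal of morphisms that factor through an $F$-projective-injective object, with quotient functor $\pi$, is a triangulated category (octahedral axiom included) in the following way. The suspension sends $\pi X$ to $\pi X'$, for a triangle $X\xrightarrow{i}I\xrightarrow{p}X'\xrightarrow{\alpha}\Sigma X$ in $\mathcal E_F$ with $I$ $F$-injective, and $\pi(f)$, for $f\colon X\to Y$, to the class of any map $X'\to Y'$ which is part of a morphism extending $f$ between two such triangles;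 up to compatible isomorphisms this does not depend on the choice of the triangles. The distinguished triangles are exactly those isomorphic to $X\xrightarrow{\pi f}Y\xrightarrow{\pi g}Z\xrightarrow{\pi h}X'$, where $X\xrightarrow{i}I\xrightarrow{p}X'\xrightarrow{\alpha}\Sigma X$ is as above, $f\colon X\to Y$ is a morphism of $\mathcal K$, $(g\colon Y\to Z,\ u\colon I\to Z)$ is a homotopy pushout of $(f,i)$, and $h\colon Z\to X'$ is such that $hu=p$ and $Y\xrightarrow{g}Z\xrightarrow{h}X'\xrightarrow{\Sigma f\circ\alpha}\Sigma Y$ is distinguished. -/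

import Mathlib

open CategoryTheory Category Limits Pretriangulated Preadditive ZeroObject

universe v u v' u'

namespace RelStable

/-- The closure of a class of objects under finite direct sums (including the empty one)
and direct summands. In a triangulated category every retract of an object is a
direct summand of it. -/
inductive addClosure {C : Type u} [Category.{v} C] [Preadditive C] [HasBinaryBiproducts C]
    (P : ObjectProperty C) : ObjectProperty C
  | of {X : C} (hX : P X) : addClosure P X
  | zero {X : C} (hX : IsZero X) : addClosure P X
  | sum {X Y : C} (hX : addClosure P X) (hY : addClosure P Y) : addClosure P (X ⊞ Y)
  | summand {X Y : C} (r : Retract X Y) (hY : addClosure P Y) : addClosure P X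

section ProperClasses

variable {C : Type u} [Category.{v} C] [HasZeroObject C] [HasShift C ℤ] [Preadditive C]
  [∀ n : ℤ, (shiftFunctor C n).Additive]

/-- An `E`-monomorphism: the first map of a triangle in `E`. -/
def IsEMono (E : Set (Triangle C)) {X Y : C} (f : X ⟶ Y) : Prop :=
  ∃ (Z : C) (g : Y ⟶ Z) (h : Z ⟶ X⟦(1 : ℤ)⟧), Triangle.mk f g h ∈ E

/-- An `E`-epimorphism: the second map of a triangle in `E`. -/
def IsEEpi (E : Set (Triangle C)) {Y Z : C} (g : Y ⟶ Z) : Prop :=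
  ∃ (X : C) (f : X ⟶ Y) (h : Z ⟶ X⟦(1 : ℤ)⟧), Triangle.mk f g h ∈ E

/-- `P` is `E`-projective if for every triangle `X ⟶ Y ⟶ Z ⟶ X⟦1⟧` in `E` the sequence
`0 → Hom(P, X) → Hom(P, Y) → Hom(P, Z) → 0` is exact. -/
def proj (E : Set (Triangle C)) : ObjectProperty C := fun P =>
  ∀ T ∈ E, Function.Injective (fun a : P ⟶ T.obj₁ => a ≫ T.mor₁) ∧
    Function.Exact (fun a : P ⟶ T.obj₁ => a ≫ T.mor₁) (fun b : P ⟶ T.obj₂ => b ≫ T.mor₂) ∧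
    Function.Surjective (fun b : P ⟶ T.obj₂ => b ≫ T.mor₂)

/-- `I` is `E`-injective if for every triangle `X ⟶ Y ⟶ Z ⟶ X⟦1⟧` in `E` the sequence
`0 → Hom(Z, I) → Hom(Y, I) → Hom(X, I) → 0` is exact. -/
def inj (E : Set (Triangle C)) : ObjectProperty C := fun I =>
  ∀ T ∈ E, Function.Injective (fun c : T.obj₃ ⟶ I => T.mor₂ ≫ c) ∧
    Function.Exact (fun c : T.obj₃ ⟶ I => T.mor₂ ≫ c) (fun b : T.obj₂ ⟶ I => T.mor₁ ≫ b) ∧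
    Function.Surjective (fun b : T.obj₂ ⟶ I => T.mor₁ ≫ b)

/-- Every object is the target of an `E`-epimorphism from an `E`-projective object. -/
def EnoughProj (E : Set (Triangle C)) : Prop :=
  ∀ X : C, ∃ (P : C) (g : P ⟶ X), proj E P ∧ IsEEpi E g

/-- Every object is the source of an `E`-monomorphism to an `E`-injective object. -/
def EnoughInj (E : Set (Triangle C)) : Prop :=
  ∀ X : C, ∃ (I : C) (f : X ⟶ I), inj E I ∧ IsEMono E f

variable [Pretriangulated C]

/-- The square
```
  X --f--> Y
  |        |
  i        g
  v        v
  I --u--> Z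
```
is homotopy cartesian: there is a distinguished triangle
`X ⟶ Y ⊞ I ⟶ Z ⟶ X⟦1⟧` with maps `(f, i)` and `(g, -u)` (in particular the square commutes).
One says that `(g, u)` is a homotopy pushout of `(f, i)` and
`(f, i)` a homotopy pullback of `(g, u)`. -/
def IsHomotopyCartesian {X Y I Z : C} (f : X ⟶ Y) (i : X ⟶ I) (g : Y ⟶ Z) (u : I ⟶ Z) : Prop :=
  ∃ d : Z ⟶ X⟦(1 : ℤ)⟧, Triangle.mk (biprod.lift f i) (biprod.desc g (-u)) d ∈ distTriang C

/-- The direct sum of two triangles. -/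
noncomputable def sumTriangle (T₁ T₂ : Triangle C) : Triangle C :=
  Triangle.mk (biprod.map T₁.mor₁ T₂.mor₁) (biprod.map T₁.mor₂ T₂.mor₂)
    (biprod.desc (T₁.mor₃ ≫ (biprod.inl : T₁.obj₁ ⟶ T₁.obj₁ ⊞ T₂.obj₁)⟦(1 : ℤ)⟧')
      (T₂.mor₃ ≫ (biprod.inr : T₂.obj₁ ⟶ T₁.obj₁ ⊞ T₂.obj₁)⟦(1 : ℤ)⟧'))

/-- A proper class of triangles. -/
structure IsProperClass (E : Set (Triangle C)) : Prop where
  distinguished : ∀ T ∈ E, T ∈ distTriang C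
  iso : ∀ T ∈ E, ∀ T' : Triangle C, Nonempty (T' ≅ T) → T' ∈ E
  shift : ∀ T ∈ E, ∀ n : ℤ, (Triangle.shiftFunctor C n).obj T ∈ E
  sum : ∀ T₁ ∈ E, ∀ T₂ ∈ E, sumTriangle T₁ T₂ ∈ E
  retract : ∀ T ∈ E, ∀ T' : Triangle C, Nonempty (Retract T' T) → T' ∈ E
  trivial₁ : ∀ X : C, Triangle.mk (𝟙 X) (0 : X ⟶ 0) 0 ∈ E
  trivial₂ : ∀ Y : C, Triangle.mk (0 : 0 ⟶ Y) (𝟙 Y) 0 ∈ E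
  pushout : ∀ {X Y I Z : C} (f : X ⟶ Y) (i : X ⟶ I) (g : Y ⟶ Z) (u : I ⟶ Z),
    IsHomotopyCartesian f i g u → IsEMono E f → IsEMono E u
  pullback : ∀ {X Y I Z : C} (f : X ⟶ Y) (i : X ⟶ I) (g : Y ⟶ Z) (u : I ⟶ Z),
    IsHomotopyCartesian f i g u → IsEEpi E u → IsEEpi E f
  saturated : ∀ {X Y I Z : C} (f : X ⟶ Y) (i : X ⟶ I) (g : Y ⟶ Z) (u : I ⟶ Z),
    IsHomotopyCartesian f i g u → IsEEpi E g → IsEEpi E f → IsEEpi E u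

/-- A Frobenius class of triangles: a proper class with enough projectives and enough
injectives, whose projectives and injectives coincide. -/
structure IsFrobeniusClass (E : Set (Triangle C)) : Prop where
  proper : IsProperClass E
  enoughProj : EnoughProj E
  enoughInj : EnoughInj E
  proj_eq_inj : proj E = inj E

end ProperClasses

section Stable

set_option linter.unusedSectionVars false

variable {C : Type u} [Category.{v} C] [HasZeroObject C] [HasShift C ℤ] [Preadditive C]
  [∀ n : ℤ, (shiftFunctor C n).Additive] [Pretriangulated C] (E : Set (Triangle C))

lemma proj_zero {X : C} (hX : IsZero X) : proj E X := by
  intro T _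
  refine ⟨fun a b _ => hX.eq_of_src a b,
    fun b => ⟨fun _ => ⟨0, hX.eq_of_src _ _⟩, fun _ => hX.eq_of_src _ _⟩, fun c => ⟨0, hX.eq_of_src _ _⟩⟩

lemma proj_sum {X Y : C} (hX : proj E X) (hY : proj E Y) : proj E (X ⊞ Y) := by
  intro T hT
  obtain ⟨iX, eX, sX⟩ := hX T hT
  obtain ⟨iY, eY, sY⟩ := hY T hT
  refine ⟨fun a b h => ?_, fun b => ⟨fun h => ?_, ?_⟩, fun c => ?_⟩
  · have h' : a ≫ T.mor₁ = b ≫ T.mor₁ := h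
    apply biprod.hom_ext'
    · exact iX (by simp [h'])
    · exact iY (by simp [h'])
  · have h' : b ≫ T.mor₂ = 0 := h
    obtain ⟨a₁, h₁⟩ := (eX (biprod.inl ≫ b)).1 (by simp [h'])
    obtain ⟨a₂, h₂⟩ := (eY (biprod.inr ≫ b)).1 (by simp [h'])
    refine ⟨biprod.desc a₁ a₂, ?_⟩
    apply biprod.hom_ext'
    · simpa using h₁
    · simpa using h₂
  · rintro ⟨a, rfl⟩
    apply biprod.hom_ext'
    · simpa using (eX (biprod.inl ≫ a ≫ T.mor₁)).2 ⟨biprod.inl ≫ a, by simp⟩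
    · simpa using (eY (biprod.inr ≫ a ≫ T.mor₁)).2 ⟨biprod.inr ≫ a, by simp⟩
  · obtain ⟨b₁, h₁⟩ := sX (biprod.inl ≫ c)
    obtain ⟨b₂, h₂⟩ := sY (biprod.inr ≫ c)
    refine ⟨biprod.desc b₁ b₂, ?_⟩
    apply biprod.hom_ext'
    · simpa using h₁
    · simpa using h₂

/-- An `E`-contractible morphism: one that factors through an `E`-projective object. -/
def IsContractible {X Y : C} (f : X ⟶ Y) : Prop :=
  ∃ (P : C) (a : X ⟶ P) (b : P ⟶ Y), proj E P ∧ a ≫ b = f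

lemma IsContractible.add {X Y : C} {f g : X ⟶ Y} (hf : IsContractible E f)
    (hg : IsContractible E g) : IsContractible E (f + g) := by
  obtain ⟨P, a, b, hP, rfl⟩ := hf
  obtain ⟨Q, c, d, hQ, rfl⟩ := hg
  exact ⟨P ⊞ Q, biprod.lift a c, biprod.desc b d, proj_sum E hP hQ, by simp⟩

lemma IsContractible.neg {X Y : C} {f : X ⟶ Y} (hf : IsContractible E f) :
    IsContractible E (-f) := by
  obtain ⟨P, a, b, hP, rfl⟩ := hf
  exact ⟨P, a, -b, hP, by simp⟩

lemma IsContractible.zero (X Y : C) : IsContractible E (0 : X ⟶ Y) :=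
  ⟨0, 0, 0, proj_zero E (isZero_zero C), by simp⟩

/-- Two parallel morphisms are identified if their difference is `E`-contractible. -/
def stableRel : HomRel C := fun _ _ f g => IsContractible E (f - g)

instance : Congruence (stableRel E) where
  equivalence :=
    { refl := fun f => by simpa [stableRel] using IsContractible.zero E _ _
      symm := fun {f g} h => by simpa [stableRel] using IsContractible.neg E h
      trans := fun {f g k} h h' => by simpa [stableRel] using IsContractible.add E h h' }
  comp_left {_ _ _} f {_ _} h := by
    obtain ⟨P, a, b, hP, hab⟩ := h
    exact ⟨P, f ≫ a, b, hP, by rw [assoc, hab, comp_sub]⟩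
  comp_right g h := by
    obtain ⟨P, a, b, hP, hab⟩ := h
    exact ⟨P, a, b ≫ g, hP, by rw [← assoc, hab, sub_comp]⟩

/-- The additive quotient of `C` by the `E`-projective objects. For a Frobenius
class `E` this is the `E`-relative stable category. -/
abbrev StableCategory := Quotient (stableRel E)

lemma stableRel_add ⦃X Y : C⦄ (f₁ f₂ g₁ g₂ : X ⟶ Y) (hf : stableRel E f₁ f₂)
    (hg : stableRel E g₁ g₂) : stableRel E (f₁ + g₁) (f₂ + g₂) := by
  have := IsContractible.add E hf hg
  rwa [← add_sub_add_comm] at this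

instance : Preadditive (StableCategory E) := Quotient.preadditive _ (stableRel_add E)

/-- The quotient functor to the relative stable category. -/
abbrev stableFunctor : C ⥤ StableCategory E := Quotient.functor _

instance : (stableFunctor E).Additive := Quotient.functor_additive _ (stableRel_add E)

instance : HasZeroObject (StableCategory E) := (stableFunctor E).hasZeroObject_of_additive

/-- A triangle `X ⟶ I ⟶ X' ⟶ X⟦1⟧` in `E` with `I` an `E`-injective object, so that
`X ⟶ I` is an `E`-injective preenvelope with cofibre `X'`. -/
def IsPreenvelopeTriangle (T : Triangle C) : Prop := T ∈ E ∧ inj E T.obj₂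

variable [HasShift (StableCategory E) ℤ]

/-- An identification of the suspension of the relative stable category with the one which sends
`X` to the cofibre `X'` of an `E`-injective preenvelope `X ⟶ I`, and
a morphism `f : X ⟶ Y` to the class of any map of cofibres `X' ⟶ Y'` which is part of a morphism
of triangles extending `f`. -/
structure SuspensionIso where
  /-- the identification of the cofibre of a preenvelope with the suspension -/
  iso : ∀ T : Triangle C, IsPreenvelopeTriangle E T →
    ((stableFunctor E).obj T.obj₃ ≅ ((stableFunctor E).obj T.obj₁)⟦(1 : ℤ)⟧)
  naturality : ∀ (T T' : Triangle C) (hT : IsPreenvelopeTriangle E T)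
    (hT' : IsPreenvelopeTriangle E T') (φ : T ⟶ T'),
    (stableFunctor E).map φ.hom₃ ≫ (iso T' hT').hom =
      (iso T hT).hom ≫ ((stableFunctor E).map φ.hom₁)⟦(1 : ℤ)⟧'

variable {E} in
/-- A triangle in the relative stable category is standard if it is isomorphic to the image
`X ⟶ Y ⟶ Z ⟶ X'` of a diagram with distinguished rows
```
  X --i--> I -----> X' -----> X⟦1⟧
  |        |        |          |
  f        u        id        f⟦1⟧
  v        v        v          v
  Y --g--> Z --h--> X' -----> Y⟦1⟧
```
whose first row is a preenvelope triangle and whose left square is a homotopy pushout. -/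
def IsStandardTriangle (σ : SuspensionIso E) (D : Triangle (StableCategory E)) : Prop :=
  ∃ (T : Triangle C) (hT : IsPreenvelopeTriangle E T) (Y Z : C) (f : T.obj₁ ⟶ Y)
    (g : Y ⟶ Z) (u : T.obj₂ ⟶ Z) (h : Z ⟶ T.obj₃),
    IsHomotopyCartesian f T.mor₁ g u ∧ u ≫ h = T.mor₂ ∧
    Triangle.mk g h (T.mor₃ ≫ f⟦(1 : ℤ)⟧') ∈ distTriang C ∧
    Nonempty (D ≅ Triangle.mk ((stableFunctor E).map f) ((stableFunctor E).map g)
      ((stableFunctor E).map h ≫ (σ.iso T hT).hom))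

end Stable

section FSplit

variable {K : Type u} {L : Type u'} [Category.{v} K] [Category.{v'} L]
  [HasZeroObject K] [HasZeroObject L] [HasShift K ℤ] [Preadditive K] [Preadditive L]
  [∀ n : ℤ, (shiftFunctor K n).Additive] [Pretriangulated K]

/-- The class of `F`-split triangles: the distinguished triangles whose third map is
killed by `F`. -/
def FSplit (F : K ⥤ L) : Set (Triangle K) :=
  {T | T ∈ distTriang K ∧ F.map T.mor₃ = 0}

end FSplit

end RelStable

/-! An exact functor sends an `F`-split triangle to a distinguished triangle with zero third map,
that is, to a split one. Hence a map is an `FSplit F`-monomorphism (epimorphism) exactly when its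
image under `F` is mono (epi), and properness reduces to diagram chases in `L`
(`isEMono_FSplit_iff`, `isEEpi_FSplit_iff`). Transposing across the adjunctions, objects `V B` are
projective and objects `U B` are injective. The counit of `V ⊣ F` and the unit of `F ⊣ U` split
after applying `F`, which gives enough projectives and injectives and exhibits each projective
(injective) as a summand of some `V B` (`U B`). The equivalence `W` makes the two images agree, so
the class is Frobenius.

Call a map phantom if `F` kills it. Phantoms `Z ⟶ X⟦1⟧` vanish when preceded by a map from a
projective, and when followed by the shift of a map to an injective. So, for a preenvelope triangle
with third map `α : X' ⟶ X⟦1⟧`, composition with `α` identifies stable maps `Z ⟶ X'` with phantoms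
`Z ⟶ X⟦1⟧` (`comp_phantom_eq_of_stab_map_eq`, `IsPreenvelopeTriangle.exists_lift`,
`IsPreenvelopeTriangle.stab_map_eq`). Functoriality of the suspension, its independence of choices
and its full faithfulness all come from this bijection; essential surjectivity comes from enough
projectives.

A standard triangle on `f` is, up to isomorphism, a triangle of `K` with third map `α ≫ f⟦1⟧'`
(`isStandardTriangle_iff`). Stable commutativity becomes strict commutativity after composing with
`α`, so completion of morphisms is inherited from `K`. Rotation uses that a homotopy pushout has two
cofibre sequences, one of which splits when its third map vanishes. For the octahedral axiom, adding
injective summands to the targets turns both maps into `F`-split monomorphisms, and the octahedron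
of `K` on these is carried over by `isStableTriangle_of_FSplit`. -/

namespace RelStable

set_option linter.unusedSectionVars false

/-! ### Distinguished triangles: retracts, sums, homotopy pushouts -/

section Triangles

variable {C : Type u} [Category.{v} C] [HasZeroObject C] [HasShift C ℤ] [Preadditive C]
  [∀ n : ℤ, (shiftFunctor C n).Additive] [Pretriangulated C]

lemma exists_lift₂ {X Y Z W : C} {f : X ⟶ Y} {g : Y ⟶ Z} {h : Z ⟶ X⟦(1 : ℤ)⟧}
    (hT : Triangle.mk f g h ∈ distTriang C) (b : W ⟶ Y) (hb : b ≫ g = 0) :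
    ∃ a : W ⟶ X, b = a ≫ f :=
  Triangle.coyoneda_exact₂ _ hT b hb

lemma exists_lift₃ {X Y Z W : C} {f : X ⟶ Y} {g : Y ⟶ Z} {h : Z ⟶ X⟦(1 : ℤ)⟧}
    (hT : Triangle.mk f g h ∈ distTriang C) (c : W ⟶ Z) (hc : c ≫ h = 0) :
    ∃ b : W ⟶ Y, c = b ≫ g :=
  Triangle.coyoneda_exact₃ _ hT c hc

lemma exists_lift₁ {X Y Z W : C} {f : X ⟶ Y} {g : Y ⟶ Z} {h : Z ⟶ X⟦(1 : ℤ)⟧}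
    (hT : Triangle.mk f g h ∈ distTriang C) (a : W ⟶ X⟦(1 : ℤ)⟧) (ha : a ≫ f⟦(1 : ℤ)⟧' = 0) :
    ∃ c : W ⟶ Z, a = c ≫ h :=
  Triangle.coyoneda_exact₁ _ hT a ha

lemma exists_desc₂ {X Y Z W : C} {f : X ⟶ Y} {g : Y ⟶ Z} {h : Z ⟶ X⟦(1 : ℤ)⟧}
    (hT : Triangle.mk f g h ∈ distTriang C) (b : Y ⟶ W) (hb : f ≫ b = 0) :
    ∃ c : Z ⟶ W, b = g ≫ c :=
  Triangle.yoneda_exact₂ _ hT b hb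

lemma exists_desc₃ {X Y Z W : C} {f : X ⟶ Y} {g : Y ⟶ Z} {h : Z ⟶ X⟦(1 : ℤ)⟧}
    (hT : Triangle.mk f g h ∈ distTriang C) (c : Z ⟶ W) (hc : g ≫ c = 0) :
    ∃ a : X⟦(1 : ℤ)⟧ ⟶ W, c = h ≫ a :=
  Triangle.yoneda_exact₃ _ hT c hc

lemma comp_zero₁₂ {X Y Z : C} {f : X ⟶ Y} {g : Y ⟶ Z} {h : Z ⟶ X⟦(1 : ℤ)⟧}
    (hT : Triangle.mk f g h ∈ distTriang C) : f ≫ g = 0 :=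
  comp_distTriang_mor_zero₁₂ _ hT

lemma comp_zero₂₃ {X Y Z : C} {f : X ⟶ Y} {g : Y ⟶ Z} {h : Z ⟶ X⟦(1 : ℤ)⟧}
    (hT : Triangle.mk f g h ∈ distTriang C) : g ≫ h = 0 :=
  comp_distTriang_mor_zero₂₃ _ hT

lemma comp_zero₃₁ {X Y Z : C} {f : X ⟶ Y} {g : Y ⟶ Z} {h : Z ⟶ X⟦(1 : ℤ)⟧}
    (hT : Triangle.mk f g h ∈ distTriang C) : h ≫ f⟦(1 : ℤ)⟧' = 0 :=
  comp_distTriang_mor_zero₃₁ _ hT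

section

variable {X Y Z X' Y' Z' : C} {f : X ⟶ Y} {g : Y ⟶ Z} {h : Z ⟶ X⟦(1 : ℤ)⟧}
    {f' : X' ⟶ Y'} {g' : Y' ⟶ Z'} {h' : Z' ⟶ X'⟦(1 : ℤ)⟧}

lemma exists_hom₃ (hT : Triangle.mk f g h ∈ distTriang C)
    (hT' : Triangle.mk f' g' h' ∈ distTriang C) (a : X ⟶ X') (b : Y ⟶ Y') (w : f ≫ b = a ≫ f') :
    ∃ c : Z ⟶ Z', g ≫ c = b ≫ g' ∧ h ≫ a⟦(1 : ℤ)⟧' = c ≫ h' :=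
  complete_distinguished_triangle_morphism _ _ hT hT' a b w

lemma exists_hom₂ (hT : Triangle.mk f g h ∈ distTriang C)
    (hT' : Triangle.mk f' g' h' ∈ distTriang C) (a : X ⟶ X') (c : Z ⟶ Z')
    (w : h ≫ a⟦(1 : ℤ)⟧' = c ≫ h') : ∃ b : Y ⟶ Y', f ≫ b = a ≫ f' ∧ g ≫ c = b ≫ g' :=
  complete_distinguished_triangle_morphism₂ _ _ hT hT' a c w

lemma distinguished_of_iso (hT : Triangle.mk f g h ∈ distTriang C) (a : X' ≅ X) (b : Y' ≅ Y)
    (c : Z' ≅ Z) (w₁ : f' ≫ b.hom = a.hom ≫ f) (w₂ : g' ≫ c.hom = b.hom ≫ g)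
    (w₃ : h' ≫ a.hom⟦(1 : ℤ)⟧' = c.hom ≫ h) : Triangle.mk f' g' h' ∈ distTriang C :=
  isomorphic_distinguished _ hT _ (Triangle.isoMk _ _ a b c w₁ w₂ w₃)

end

lemma rotate_distinguished_iff {X Y Z : C} {f : X ⟶ Y} {g : Y ⟶ Z} {h : Z ⟶ X⟦(1 : ℤ)⟧} :
    Triangle.mk f g h ∈ distTriang C ↔ Triangle.mk g h (-f⟦(1 : ℤ)⟧') ∈ distTriang C :=
  rotate_distinguished_triangle _

lemma biprod_distinguished (X Y : C) :
    Triangle.mk (biprod.inl : X ⟶ X ⊞ Y) (biprod.snd : X ⊞ Y ⟶ Y) 0 ∈ distTriang C :=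
  binaryBiproductTriangle_distinguished X Y

lemma exists_octahedron [IsTriangulated C] {X₁ X₂ X₃ Z₁₂ Z₂₃ Z₁₃ : C}
    {u₁₂ : X₁ ⟶ X₂} {u₂₃ : X₂ ⟶ X₃} {u₁₃ : X₁ ⟶ X₃} (comm : u₁₂ ≫ u₂₃ = u₁₃)
    {v₁₂ : X₂ ⟶ Z₁₂} {w₁₂ : Z₁₂ ⟶ X₁⟦(1 : ℤ)⟧} (h₁₂ : Triangle.mk u₁₂ v₁₂ w₁₂ ∈ distTriang C)
    {v₂₃ : X₃ ⟶ Z₂₃} {w₂₃ : Z₂₃ ⟶ X₂⟦(1 : ℤ)⟧} (h₂₃ : Triangle.mk u₂₃ v₂₃ w₂₃ ∈ distTriang C)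
    {v₁₃ : X₃ ⟶ Z₁₃} {w₁₃ : Z₁₃ ⟶ X₁⟦(1 : ℤ)⟧} (h₁₃ : Triangle.mk u₁₃ v₁₃ w₁₃ ∈ distTriang C) :
    ∃ (m₁ : Z₁₂ ⟶ Z₁₃) (m₃ : Z₁₃ ⟶ Z₂₃), v₁₂ ≫ m₁ = u₂₃ ≫ v₁₃ ∧ m₁ ≫ w₁₃ = w₁₂ ∧
      v₁₃ ≫ m₃ = v₂₃ ∧ w₁₃ ≫ u₁₂⟦1⟧' = m₃ ≫ w₂₃ ∧
      Triangle.mk m₁ m₃ (w₂₃ ≫ v₁₂⟦1⟧') ∈ distTriang C :=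
  let o := Triangulated.someOctahedron comm h₁₂ h₂₃ h₁₃
  ⟨o.m₁, o.m₃, o.comm₁, o.comm₂, o.comm₃, o.comm₄, o.mem⟩

/-- A triangle with exact rows of morphisms which receives a morphism from the cone of its first
map is distinguished. -/
lemma distinguished_of_exact {X Y Z Z' : C} {f : X ⟶ Y} {g : Y ⟶ Z} {h : Z ⟶ X⟦(1 : ℤ)⟧}
    {g' : Y ⟶ Z'} {h' : Z' ⟶ X⟦(1 : ℤ)⟧} (hT : Triangle.mk f g' h' ∈ distTriang C)
    (φ : Z' ⟶ Z) (hg : g' ≫ φ = g) (hh : φ ≫ h = h')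
    (ex₂ : ∀ (W : C) (b : W ⟶ Y), b ≫ g = 0 → ∃ a : W ⟶ X, b = a ≫ f)
    (ex₃ : ∀ (W : C) (c : W ⟶ Z), c ≫ h = 0 → ∃ b : W ⟶ Y, c = b ≫ g)
    (zero : h ≫ f⟦(1 : ℤ)⟧' = 0) : Triangle.mk f g h ∈ distTriang C := by
  have hfg : f ≫ g' = 0 := comp_distTriang_mor_zero₁₂ _ hT
  -- Half of the five lemma: exactness of both rows at the second object makes `φ` mono. A right
  -- inverse built below then makes it invertible.
  have : Mono φ := by
    apply Preadditive.mono_of_cancel_zero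
    intro W a ha
    obtain ⟨b, hb⟩ : ∃ b : W ⟶ Y, a = b ≫ g' :=
      exists_lift₃ hT a (by rw [← hh, reassoc_of% ha, zero_comp])
    obtain ⟨c, rfl⟩ := ex₂ W b (by rw [← hg, ← assoc, ← hb, ha])
    rw [hb, assoc, hfg, comp_zero]
  obtain ⟨a, ha⟩ : ∃ a : Z ⟶ Z', h = a ≫ h' :=
    exists_lift₁ hT h zero
  -- The lift `a` of `h` is a right inverse of `φ` only up to a map killed by `h`; that error comes
  -- from `Y` and is corrected through `g'`.
  obtain ⟨b, hb⟩ := ex₃ Z (𝟙 Z - a ≫ φ) (by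
    rw [sub_comp, id_comp, assoc, hh, ← ha, sub_self])
  have fac : (a + b ≫ g') ≫ φ = 𝟙 Z := by
    rw [add_comp, assoc, hg, ← hb]; abel
  have : IsSplitEpi φ := ⟨⟨_, fac⟩⟩
  have : IsIso φ := isIso_of_mono_of_isSplitEpi φ
  exact distinguished_of_iso hT (Iso.refl _) (Iso.refl _) (asIso φ).symm (by simp)
    (by simp [← hg]) (by simp [← hh])

/-- Exactness of the Hom sequences passes to retracts, and the cone of `T'.mor₁` maps to `T'` by way
of `T`; `distinguished_of_exact` concludes. -/
lemma distinguished_of_retract {T T' : Triangle C} (hT : T ∈ distTriang C) (r : Retract T' T) :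
    T' ∈ distTriang C := by
  obtain ⟨Z, g, h, hZ⟩ := distinguished_cocone_triangle T'.mor₁
  obtain ⟨c, hc₁, hc₂⟩ := exists_hom₃ hZ hT r.i.hom₁ r.i.hom₂ r.i.comm₁
  have e₁ : r.i.hom₁ ≫ r.r.hom₁ = 𝟙 _ := by rw [← comp_hom₁, r.retract, id_hom₁]
  have e₂ : r.i.hom₂ ≫ r.r.hom₂ = 𝟙 _ := by rw [← comp_hom₂, r.retract, id_hom₂]
  have e₃ : r.i.hom₃ ≫ r.r.hom₃ = 𝟙 _ := by rw [← comp_hom₃, r.retract, id_hom₃]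
  refine distinguished_of_exact (f := T'.mor₁) (g := T'.mor₂) (h := T'.mor₃) hZ
    (c ≫ r.r.hom₃) ?_ ?_ ?_ ?_ ?_
  · rw [reassoc_of% hc₁, r.r.comm₂, reassoc_of% e₂]
  · rw [assoc, ← r.r.comm₃, ← reassoc_of% hc₂, ← Functor.map_comp, e₁,
      CategoryTheory.Functor.map_id, comp_id]
  · intro W b hb
    obtain ⟨a, ha⟩ := Triangle.coyoneda_exact₂ _ hT (b ≫ r.i.hom₂) (by
      rw [assoc, ← r.i.comm₂, reassoc_of% hb, zero_comp])
    refine ⟨a ≫ r.r.hom₁, ?_⟩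
    rw [assoc, ← r.r.comm₁, ← reassoc_of% ha, e₂, comp_id]
  · intro W b hb
    obtain ⟨a, ha⟩ := Triangle.coyoneda_exact₃ _ hT (b ≫ r.i.hom₃) (by
      rw [assoc, ← r.i.comm₃, reassoc_of% hb, zero_comp])
    refine ⟨a ≫ r.r.hom₂, ?_⟩
    rw [assoc, ← r.r.comm₂, ← reassoc_of% ha, e₃, comp_id]
  · have h₁ := r.i.comm₁
    have h₂ : r.r.hom₁⟦(1 : ℤ)⟧' ≫ T'.mor₁⟦(1 : ℤ)⟧' = T.mor₁⟦(1 : ℤ)⟧' ≫ r.r.hom₂⟦(1 : ℤ)⟧' := by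
      rw [← Functor.map_comp, ← Functor.map_comp, r.r.comm₁]
    have h₃ : T'.mor₃ = r.i.hom₃ ≫ T.mor₃ ≫ r.r.hom₁⟦(1 : ℤ)⟧' := by
      rw [r.r.comm₃, reassoc_of% e₃]
    rw [h₃, assoc, assoc, h₂, comp_distTriang_mor_zero₃₁_assoc _ hT, zero_comp, comp_zero]

lemma sumTriangle_distinguished {T₁ T₂ : Triangle C} (h₁ : T₁ ∈ distTriang C)
    (h₂ : T₂ ∈ distTriang C) : sumTriangle T₁ T₂ ∈ distTriang C := by
  obtain ⟨Z, g, h, hZ⟩ := distinguished_cocone_triangle (biprod.map T₁.mor₁ T₂.mor₁)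
  obtain ⟨c₁, hc₁, hc₁'⟩ := exists_hom₃ hZ h₁ biprod.fst
    biprod.fst (by simp)
  obtain ⟨c₂, hc₂, hc₂'⟩ := exists_hom₃ hZ h₂ biprod.snd
    biprod.snd (by simp)
  have total : ((biprod.fst : T₁.obj₁ ⊞ T₂.obj₁ ⟶ _) ≫ biprod.inl)⟦(1 : ℤ)⟧' +
      ((biprod.snd : T₁.obj₁ ⊞ T₂.obj₁ ⟶ _) ≫ biprod.inr)⟦(1 : ℤ)⟧' = 𝟙 _ := by
    rw [← Functor.map_add, biprod.total, CategoryTheory.Functor.map_id]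
  refine distinguished_of_exact hZ (biprod.lift c₁ c₂) ?_ ?_ ?_ ?_ ?_
  · ext <;> simp [hc₁, hc₂]
  · rw [biprod.lift_desc, ← reassoc_of% hc₁', ← reassoc_of% hc₂', ← Functor.map_comp,
      ← Functor.map_comp, ← comp_add, total, comp_id]
  · intro W b hb
    obtain ⟨a₁, ha₁⟩ := Triangle.coyoneda_exact₂ _ h₁ (b ≫ biprod.fst) (by
      simpa using hb =≫ biprod.fst)
    obtain ⟨a₂, ha₂⟩ := Triangle.coyoneda_exact₂ _ h₂ (b ≫ biprod.snd) (by
      simpa using hb =≫ biprod.snd)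
    exact ⟨biprod.lift a₁ a₂, by ext <;> simp [ha₁, ha₂]⟩
  · intro W b hb
    have fst : (biprod.inl : T₁.obj₁ ⟶ T₁.obj₁ ⊞ T₂.obj₁)⟦(1 : ℤ)⟧' ≫ biprod.fst⟦(1 : ℤ)⟧' = 𝟙 _ := by
      rw [← Functor.map_comp, biprod.inl_fst, CategoryTheory.Functor.map_id]
    have snd : (biprod.inr : T₂.obj₁ ⟶ T₁.obj₁ ⊞ T₂.obj₁)⟦(1 : ℤ)⟧' ≫ biprod.snd⟦(1 : ℤ)⟧' = 𝟙 _ := by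
      rw [← Functor.map_comp, biprod.inr_snd, CategoryTheory.Functor.map_id]
    have ifst : (biprod.inr : T₂.obj₁ ⟶ T₁.obj₁ ⊞ T₂.obj₁)⟦(1 : ℤ)⟧' ≫ biprod.fst⟦(1 : ℤ)⟧' = 0 := by
      rw [← Functor.map_comp, biprod.inr_fst, Functor.map_zero]
    have isnd : (biprod.inl : T₁.obj₁ ⟶ T₁.obj₁ ⊞ T₂.obj₁)⟦(1 : ℤ)⟧' ≫ biprod.snd⟦(1 : ℤ)⟧' = 0 := by
      rw [← Functor.map_comp, biprod.inl_snd, Functor.map_zero]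
    have hb' : b ≫ biprod.fst ≫ T₁.mor₃ ≫ biprod.inl⟦(1 : ℤ)⟧' +
        b ≫ biprod.snd ≫ T₂.mor₃ ≫ biprod.inr⟦(1 : ℤ)⟧' = 0 := by
      rw [← hb, biprod.desc_eq, comp_add]
    obtain ⟨a₁, ha₁⟩ := Triangle.coyoneda_exact₃ _ h₁ (b ≫ biprod.fst) (by
      simpa [fst, ifst] using hb' =≫ ((shiftFunctor C (1 : ℤ)).map biprod.fst))
    obtain ⟨a₂, ha₂⟩ := Triangle.coyoneda_exact₃ _ h₂ (b ≫ biprod.snd) (by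
      simpa [snd, isnd] using hb' =≫ ((shiftFunctor C (1 : ℤ)).map biprod.snd))
    exact ⟨biprod.lift a₁ a₂, by ext <;> simp [ha₁, ha₂]⟩
  · ext
    · rw [biprod.inl_desc_assoc, assoc, ← Functor.map_comp, biprod.inl_map, Functor.map_comp,
        comp_distTriang_mor_zero₃₁_assoc _ h₁, zero_comp, comp_zero]
    · rw [biprod.inr_desc_assoc, assoc, ← Functor.map_comp, biprod.inr_map, Functor.map_comp,
        comp_distTriang_mor_zero₃₁_assoc _ h₂, zero_comp, comp_zero]

lemma exists_homotopyPushout {X Y I : C} (f : X ⟶ Y) (i : X ⟶ I) :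
    ∃ (Z : C) (g : Y ⟶ Z) (u : I ⟶ Z) (d : Z ⟶ X⟦(1 : ℤ)⟧),
      Triangle.mk (biprod.lift f i) (biprod.desc g (-u)) d ∈ distTriang C := by
  obtain ⟨Z, v, d, h⟩ := distinguished_cocone_triangle (biprod.lift f i)
  refine ⟨Z, biprod.inl ≫ v, -(biprod.inr ≫ v), d, ?_⟩
  convert h
  ext <;> simp

/-- The cofibre of a map is also the cofibre of its homotopy pushout. -/
lemma exists_cofibre_of_homotopyPushout [IsTriangulated C] {X Y I Z X' : C} {f : X ⟶ Y}
    {i : X ⟶ I} {g : Y ⟶ Z} {u : I ⟶ Z} {d : Z ⟶ X⟦(1 : ℤ)⟧}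
    (hd : Triangle.mk (biprod.lift f i) (biprod.desc g (-u)) d ∈ distTriang C)
    {p : I ⟶ X'} {α : X' ⟶ X⟦(1 : ℤ)⟧} (hT : Triangle.mk i p α ∈ distTriang C) :
    ∃ h : Z ⟶ X', u ≫ h = p ∧ Triangle.mk g h (α ≫ f⟦(1 : ℤ)⟧') ∈ distTriang C ∧
      d = -(h ≫ α) := by
  have h₂₃ := rotate_distinguished_iff.1 (biprod_distinguished Y I)
  -- The octahedron on the factorization of `i` as `(f, i)` followed by the projection to `I`. The
  -- sign of `-u` in the homotopy cartesian triangle forces `h` to be `-m₁`, whence the sign in `d`.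
  obtain ⟨m₁, m₃, c₁, c₂, -, c₄, hm⟩ := exists_octahedron (biprod.lift_snd f i) hd h₂₃ hT
  replace c₄ := c₄ =≫ ((shiftFunctor C (1 : ℤ)).map (biprod.fst : Y ⊞ I ⟶ Y))
  have e₁ : g ≫ m₁ = 0 := by simpa using biprod.inl ≫= c₁
  have e₂ : u ≫ (-m₁) = p := by simpa using biprod.inr ≫= c₁
  have e₃ : m₃ = -(α ≫ f⟦(1 : ℤ)⟧') := by
    rw [assoc, assoc, ← Functor.map_comp, biprod.lift_fst, neg_comp, ← Functor.map_comp,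
      biprod.inl_fst, CategoryTheory.Functor.map_id, comp_neg, comp_id] at c₄
    rw [c₄, neg_neg]
  refine ⟨-m₁, e₂, ?_, by rw [neg_comp, neg_neg, c₂]⟩
  rw [rotate_distinguished_iff]
  refine distinguished_of_iso hm (Iso.refl _) (-Iso.refl _)
    (Iso.refl _) (by simp) (by simp [e₃]) ?_
  rw [Iso.refl_hom, CategoryTheory.Functor.map_id, comp_id, Iso.refl_hom, id_comp, neg_comp,
    ← Functor.map_comp, biprod.inl_desc]

end Triangles

/-! ### Closure properties of projectives and injectives -/

section InjectiveClosure

variable {C : Type u} [Category.{v} C] [HasZeroObject C] [HasShift C ℤ] [Preadditive C]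
  [∀ n : ℤ, (shiftFunctor C n).Additive] [Pretriangulated C] {E : Set (Triangle C)}

lemma inj_zero {X : C} (hX : IsZero X) : inj E X := by
  intro T _
  exact ⟨fun a b _ => hX.eq_of_tgt a b, fun b => ⟨fun _ => ⟨0, hX.eq_of_tgt _ _⟩,
    fun _ => hX.eq_of_tgt _ _⟩, fun c => ⟨0, hX.eq_of_tgt _ _⟩⟩

lemma inj_sum {X Y : C} (hX : inj E X) (hY : inj E Y) : inj E (X ⊞ Y) := by
  intro T hT
  obtain ⟨iX, eX, sX⟩ := hX T hT
  obtain ⟨iY, eY, sY⟩ := hY T hT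
  refine ⟨fun a b h => ?_, fun b => ⟨fun h => ?_, ?_⟩, fun c => ?_⟩
  · have h' : T.mor₂ ≫ a = T.mor₂ ≫ b := h
    apply biprod.hom_ext
    · exact iX (by simp [reassoc_of% h'])
    · exact iY (by simp [reassoc_of% h'])
  · have h' : T.mor₁ ≫ b = 0 := h
    obtain ⟨a₁, h₁⟩ := (eX (b ≫ biprod.fst)).1 (by simp [reassoc_of% h'])
    obtain ⟨a₂, h₂⟩ := (eY (b ≫ biprod.snd)).1 (by simp [reassoc_of% h'])
    refine ⟨biprod.lift a₁ a₂, ?_⟩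
    apply biprod.hom_ext
    · simpa using h₁
    · simpa using h₂
  · rintro ⟨a, rfl⟩
    apply biprod.hom_ext
    · simpa using (eX (T.mor₂ ≫ a ≫ biprod.fst)).2 ⟨a ≫ biprod.fst, by simp⟩
    · simpa using (eY (T.mor₂ ≫ a ≫ biprod.snd)).2 ⟨a ≫ biprod.snd, by simp⟩
  · obtain ⟨b₁, h₁⟩ := sX (c ≫ biprod.fst)
    obtain ⟨b₂, h₂⟩ := sY (c ≫ biprod.snd)
    refine ⟨biprod.lift b₁ b₂, ?_⟩
    apply biprod.hom_ext
    · simpa using h₁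
    · simpa using h₂

lemma inj_retract {X Y : C} (r : Retract X Y) (hY : inj E Y) : inj E X := by
  intro T hT
  obtain ⟨iY, eY, sY⟩ := hY T hT
  refine ⟨fun a b h => ?_, fun b => ⟨fun h => ?_, ?_⟩, fun c => ?_⟩
  · have h' : T.mor₂ ≫ a = T.mor₂ ≫ b := h
    have : a ≫ r.i = b ≫ r.i := iY (by simp [reassoc_of% h'])
    simpa using this =≫ r.r
  · have h' : T.mor₁ ≫ b = 0 := h
    obtain ⟨a, ha⟩ := (eY (b ≫ r.i)).1 (by simp [reassoc_of% h'])
    exact ⟨a ≫ r.r, by simpa using ha =≫ r.r⟩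
  · rintro ⟨a, rfl⟩
    simpa using (eY (T.mor₂ ≫ a ≫ r.i)).2 ⟨a ≫ r.i, by simp⟩ =≫ r.r
  · obtain ⟨b, hb⟩ := sY (c ≫ r.i)
    exact ⟨b ≫ r.r, by simpa using hb =≫ r.r⟩

lemma proj_retract {X Y : C} (r : Retract X Y) (hY : proj E Y) : proj E X := by
  intro T hT
  obtain ⟨iY, eY, sY⟩ := hY T hT
  refine ⟨fun a b h => ?_, fun b => ⟨fun h => ?_, ?_⟩, fun c => ?_⟩
  · have h' : a ≫ T.mor₁ = b ≫ T.mor₁ := h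
    have : r.r ≫ a = r.r ≫ b := iY (by simp [h'])
    simpa using r.i ≫= this
  · have h' : b ≫ T.mor₂ = 0 := h
    obtain ⟨a, ha⟩ := (eY (r.r ≫ b)).1 (by simp [h'])
    exact ⟨r.i ≫ a, by simpa using r.i ≫= ha⟩
  · rintro ⟨a, rfl⟩
    simpa using r.i ≫= (eY (r.r ≫ a ≫ T.mor₁)).2 ⟨r.r ≫ a, by simp⟩
  · obtain ⟨b, hb⟩ := sY (r.r ≫ c)
    exact ⟨r.i ≫ b, by simpa using r.i ≫= hb⟩

lemma addClosure_le_proj {P : ObjectProperty C} (h : ∀ X, P X → proj E X) {X : C}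
    (hX : addClosure P X) : proj E X := by
  induction hX with
  | of hX => exact h _ hX
  | zero hX => exact proj_zero E hX
  | sum _ _ h₁ h₂ => exact proj_sum E h₁ h₂
  | summand r _ h => exact proj_retract r h

lemma addClosure_le_inj {P : ObjectProperty C} (h : ∀ X, P X → inj E X) {X : C}
    (hX : addClosure P X) : inj E X := by
  induction hX with
  | of hX => exact h _ hX
  | zero hX => exact inj_zero hX
  | sum _ _ h₁ h₂ => exact inj_sum h₁ h₂
  | summand r _ h => exact inj_retract r h

end InjectiveClosure

/-! ### Properness of the class of `F`-split triangles, its projectives and injectives -/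

section FSplitTriangles

variable {K : Type u} [Category.{v} K] [HasZeroObject K] [HasShift K ℤ] [Preadditive K]
  [∀ n : ℤ, (shiftFunctor K n).Additive] [Pretriangulated K]
  {L : Type u'} [Category.{v'} L] [HasZeroObject L] [HasShift L ℤ] [Preadditive L]
  [∀ n : ℤ, (shiftFunctor L n).Additive] [Pretriangulated L]
  {F : K ⥤ L} [F.CommShift ℤ] [F.IsTriangulated]

lemma map_distinguished' {X Y Z : K} {f : X ⟶ Y} {g : Y ⟶ Z} {h : Z ⟶ X⟦(1 : ℤ)⟧}
    (hT : Triangle.mk f g h ∈ distTriang K) :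
    Triangle.mk (F.map f) (F.map g) (F.map h ≫ (F.commShiftIso (1 : ℤ)).hom.app X) ∈
      distTriang L :=
  F.map_distinguished _ hT

lemma map_mor₃_comp_eq_zero_iff {X Z : K} {h : Z ⟶ X⟦(1 : ℤ)⟧} :
    F.map h ≫ (F.commShiftIso (1 : ℤ)).hom.app X = 0 ↔ F.map h = 0 := by
  rw [← cancel_mono ((F.commShiftIso (1 : ℤ)).hom.app X), zero_comp]

lemma map_mor₃_eq_zero_iff_mono {X Y Z : K} {f : X ⟶ Y} {g : Y ⟶ Z} {h : Z ⟶ X⟦(1 : ℤ)⟧}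
    (hT : Triangle.mk f g h ∈ distTriang K) : F.map h = 0 ↔ Mono (F.map f) := by
  rw [← map_mor₃_comp_eq_zero_iff]
  exact Triangle.mor₃_eq_zero_iff_mono₁ _ (map_distinguished' (F := F) hT)

lemma map_mor₃_eq_zero_iff_epi {X Y Z : K} {f : X ⟶ Y} {g : Y ⟶ Z} {h : Z ⟶ X⟦(1 : ℤ)⟧}
    (hT : Triangle.mk f g h ∈ distTriang K) : F.map h = 0 ↔ Epi (F.map g) := by
  rw [← map_mor₃_comp_eq_zero_iff]
  exact Triangle.mor₃_eq_zero_iff_epi₂ _ (map_distinguished' (F := F) hT)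

/-- In a distinguished triangle of `L` the third map vanishes exactly when the first is mono. The
criterion no longer mentions the chosen cone. -/
lemma isEMono_FSplit_iff {X Y : K} (f : X ⟶ Y) : IsEMono (FSplit F) f ↔ Mono (F.map f) := by
  constructor
  · rintro ⟨Z, g, h, hT, h₀⟩
    exact (map_mor₃_eq_zero_iff_mono hT).1 h₀
  · intro hf
    obtain ⟨Z, g, h, hT⟩ := distinguished_cocone_triangle f
    exact ⟨Z, g, h, hT, (map_mor₃_eq_zero_iff_mono hT).2 hf⟩

lemma isEEpi_FSplit_iff {Y Z : K} (g : Y ⟶ Z) : IsEEpi (FSplit F) g ↔ Epi (F.map g) := by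
  constructor
  · rintro ⟨X, f, h, hT, h₀⟩
    exact (map_mor₃_eq_zero_iff_epi hT).1 h₀
  · intro hg
    obtain ⟨X, f, h, hT⟩ := distinguished_cocone_triangle₁ g
    exact ⟨X, f, h, hT, (map_mor₃_eq_zero_iff_epi hT).2 hg⟩

lemma map_shift_eq_zero {X Y : K} {f : X ⟶ Y} (hf : F.map f = 0) (n : ℤ) :
    F.map (f⟦n⟧') = 0 := by
  rw [← cancel_mono ((F.commShiftIso n).hom.app Y), Functor.commShiftIso_hom_naturality, hf,
    Functor.map_zero, comp_zero, zero_comp]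

lemma mono_iff_of_distinguished_lift {X Y I Z : K} {f : X ⟶ Y} {i : X ⟶ I} {g : Y ⟶ Z}
    {u : I ⟶ Z} (h : IsHomotopyCartesian f i g u) (hf : Mono (F.map f)) : Mono (F.map u) := by
  obtain ⟨d, hd⟩ := h
  apply Preadditive.mono_of_cancel_zero
  intro W a ha
  obtain ⟨b, hb⟩ := exists_lift₂ (map_distinguished' (F := F) hd) (a ≫ F.map biprod.inr) (by
    rw [assoc, ← F.map_comp, biprod.inr_desc, F.map_neg, comp_neg, ha, neg_zero])
  have hb₁ : b ≫ F.map f = 0 := by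
    have := hb =≫ F.map biprod.fst
    rw [assoc, assoc, ← F.map_comp, ← F.map_comp, biprod.inr_fst, biprod.lift_fst, F.map_zero,
      comp_zero] at this
    exact this.symm
  have hb₂ : b = 0 := by rwa [← cancel_mono (F.map f), zero_comp]
  have := hb =≫ F.map biprod.snd
  rwa [assoc, ← F.map_comp, biprod.inr_snd, F.map_id, comp_id, hb₂, zero_comp, zero_comp] at this

lemma epi_of_homotopyPullback {X Y I Z : K} {f : X ⟶ Y} {i : X ⟶ I} {g : Y ⟶ Z}
    {u : I ⟶ Z} (h : IsHomotopyCartesian f i g u) (hu : Epi (F.map u)) : Epi (F.map f) := by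
  obtain ⟨d, hd⟩ := h
  apply Preadditive.epi_of_cancel_zero
  intro W a ha
  obtain ⟨b, hb⟩ := exists_desc₂ (map_distinguished' (F := F) hd) (F.map biprod.fst ≫ a) (by
    rw [← assoc, ← F.map_comp, biprod.lift_fst, ha])
  have hb₁ : F.map u ≫ b = 0 := by
    have := F.map biprod.inr ≫= hb
    rw [← assoc, ← assoc, ← F.map_comp, ← F.map_comp, biprod.inr_fst, biprod.inr_desc, F.map_zero,
      zero_comp, F.map_neg, neg_comp] at this
    exact neg_eq_zero.1 this.symm
  have hb₂ : b = 0 := by rwa [← cancel_epi (F.map u), comp_zero]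
  have := F.map biprod.inl ≫= hb
  rwa [← assoc, ← F.map_comp, biprod.inl_fst, F.map_id, id_comp, hb₂, comp_zero, comp_zero] at this

/-- Only commutativity of the square matters: `F.map u` is the last factor of an epimorphism. -/
lemma epi_of_homotopyPullback_along_epi {X Y I Z : K} {f : X ⟶ Y} {i : X ⟶ I} {g : Y ⟶ Z}
    {u : I ⟶ Z} (h : IsHomotopyCartesian f i g u) (hg : Epi (F.map g)) (hf : Epi (F.map f)) :
    Epi (F.map u) := by
  obtain ⟨d, hd⟩ := h
  have w : f ≫ g = i ≫ u := by
    simpa [← sub_eq_add_neg, sub_eq_zero] using comp_zero₁₂ hd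
  apply Preadditive.epi_of_cancel_zero
  intro W a ha
  rw [← cancel_epi (F.map g), ← cancel_epi (F.map f), comp_zero, ← F.map_comp_assoc, w, F.map_comp,
    assoc, ha, comp_zero, comp_zero]

lemma isProperClass_FSplit : IsProperClass (FSplit F) where
  distinguished _ hT := hT.1
  iso T hT T' := by
    rintro ⟨e⟩
    refine ⟨isomorphic_distinguished _ hT.1 _ e, ?_⟩
    have h := e.hom.comm₃ =≫ e.inv.hom₁⟦(1 : ℤ)⟧'
    rw [assoc, ← Functor.map_comp, Iso.hom_inv_id_triangle_hom₁, CategoryTheory.Functor.map_id,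
      comp_id] at h
    rw [h, F.map_comp, F.map_comp, hT.2, comp_zero, zero_comp]
  shift T hT n := by
    refine ⟨Triangle.shift_distinguished _ hT.1 n, ?_⟩
    have h : F.map (T.mor₃⟦n⟧' ≫ (shiftFunctorComm K 1 n).hom.app T.obj₁) = 0 := by
      rw [F.map_comp, map_shift_eq_zero hT.2 n, zero_comp]
    -- Shifting a triangle by `n` multiplies its maps by the sign `(-1)^n`, which does not affect
    -- vanishing.
    change F.map (n.negOnePow • (T.mor₃⟦n⟧' ≫ (shiftFunctorComm K 1 n).hom.app T.obj₁)) = 0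
    obtain hn | hn := Int.even_or_odd n
    · rw [Int.negOnePow_even n hn, one_smul, h]
    · rw [Int.negOnePow_odd n hn, Units.neg_smul, one_smul, F.map_neg, h, neg_zero]
  sum T₁ h₁ T₂ h₂ := by
    refine ⟨sumTriangle_distinguished h₁.1 h₂.1, ?_⟩
    change F.map (biprod.desc
      (T₁.mor₃ ≫ (biprod.inl : T₁.obj₁ ⟶ T₁.obj₁ ⊞ T₂.obj₁)⟦(1 : ℤ)⟧')
      (T₂.mor₃ ≫ (biprod.inr : T₂.obj₁ ⟶ T₁.obj₁ ⊞ T₂.obj₁)⟦(1 : ℤ)⟧')) = 0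
    rw [biprod.desc_eq, F.map_add, F.map_comp, F.map_comp, F.map_comp, F.map_comp, h₁.2, h₂.2,
      zero_comp, zero_comp, comp_zero, comp_zero, add_zero]
  retract T hT T' := by
    rintro ⟨r⟩
    refine ⟨distinguished_of_retract hT.1 r, ?_⟩
    have e₁ : r.i.hom₁ ≫ r.r.hom₁ = 𝟙 _ := by rw [← comp_hom₁, r.retract, id_hom₁]
    have h := r.i.comm₃ =≫ r.r.hom₁⟦(1 : ℤ)⟧'
    rw [assoc, ← Functor.map_comp, e₁,
      CategoryTheory.Functor.map_id, comp_id] at h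
    rw [h, F.map_comp, F.map_comp, hT.2, comp_zero, zero_comp]
  trivial₁ X := ⟨contractible_distinguished X, F.map_zero _ _⟩
  trivial₂ Y := ⟨contractible_distinguished₁ Y, F.map_zero _ _⟩
  pushout f i g u h hf := by
    rw [isEMono_FSplit_iff] at hf ⊢
    exact mono_iff_of_distinguished_lift h hf
  pullback f i g u h hu := by
    rw [isEEpi_FSplit_iff] at hu ⊢
    exact epi_of_homotopyPullback h hu
  saturated f i g u h hg hf := by
    rw [isEEpi_FSplit_iff] at hg hf ⊢
    exact epi_of_homotopyPullback_along_epi h hg hf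

section LeftAdjoint

variable {V : L ⥤ K} (adj : V ⊣ F)
include adj

/-- Maps out of `V B` are maps from `B` into the image under `F`, where the first map of the
triangle is mono and the second is split epi. Exactness in the middle already holds in `K`. -/
lemma proj_leftAdjoint_obj (B : L) : proj (FSplit F) (V.obj B) := by
  rintro T ⟨hT, h₀⟩
  have hm : Mono (F.map T.mor₁) := (map_mor₃_eq_zero_iff_mono hT).1 h₀
  have he : Epi (F.map T.mor₂) := (map_mor₃_eq_zero_iff_epi hT).1 h₀
  refine ⟨fun a b h => ?_, fun b => ⟨fun h => ?_, ?_⟩, fun c => ?_⟩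
  · have h' : a ≫ T.mor₁ = b ≫ T.mor₁ := h
    apply (adj.homEquiv _ _).injective
    rw [← cancel_mono (F.map T.mor₁), ← adj.homEquiv_naturality_right, h',
      adj.homEquiv_naturality_right]
  · obtain ⟨a, ha⟩ := exists_lift₂ hT b h
    exact ⟨a, ha.symm⟩
  · rintro ⟨a, rfl⟩
    change (a ≫ T.mor₁) ≫ T.mor₂ = 0
    rw [assoc, comp_distTriang_mor_zero₁₂ _ hT, comp_zero]
  · have := isSplitEpi_of_epi (F.map T.mor₂)
    refine ⟨(adj.homEquiv _ _).symm (adj.homEquiv _ _ c ≫ section_ (F.map T.mor₂)), ?_⟩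
    apply (adj.homEquiv _ _).injective
    dsimp only
    rw [adj.homEquiv_naturality_right, Equiv.apply_symm_apply, assoc, IsSplitEpi.id, comp_id]

lemma epi_map_counit (X : K) : Epi (F.map (adj.counit.app X)) :=
  have : IsSplitEpi (F.map (adj.counit.app X)) := ⟨⟨_, adj.right_triangle_components X⟩⟩
  inferInstance

/-- The counit is an `FSplit F`-epimorphism by a triangle identity, so it splits over a projective,
which is thus a summand of `V (F P)`. -/
lemma proj_FSplit_eq : proj (FSplit F) = addClosure V.essImage := by
  ext P
  constructor
  · intro hP
    obtain ⟨X, f, h, hT⟩ := (isEEpi_FSplit_iff _).2 (epi_map_counit adj P)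
    obtain ⟨s, hs⟩ := (hP _ hT).2.2 (𝟙 P)
    exact .summand ⟨s, adj.counit.app P, hs⟩ (.of (V.obj_mem_essImage _))
  · apply addClosure_le_proj
    rintro X ⟨B, ⟨e⟩⟩
    exact proj_retract (Retract.ofIso e.symm) (proj_leftAdjoint_obj adj B)

lemma enoughProj_FSplit : EnoughProj (FSplit F) := fun X =>
  ⟨_, adj.counit.app X, proj_leftAdjoint_obj adj _, (isEEpi_FSplit_iff _).2 (epi_map_counit adj X)⟩

end LeftAdjoint

section RightAdjoint

variable {U : L ⥤ K} (adj : F ⊣ U)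
include adj

lemma inj_rightAdjoint_obj (B : L) : inj (FSplit F) (U.obj B) := by
  rintro T ⟨hT, h₀⟩
  have hm : Mono (F.map T.mor₁) := (map_mor₃_eq_zero_iff_mono hT).1 h₀
  have he : Epi (F.map T.mor₂) := (map_mor₃_eq_zero_iff_epi hT).1 h₀
  refine ⟨fun a b h => ?_, fun b => ⟨fun h => ?_, ?_⟩, fun c => ?_⟩
  · have h' : T.mor₂ ≫ a = T.mor₂ ≫ b := h
    apply (adj.homEquiv _ _).symm.injective
    rw [← cancel_epi (F.map T.mor₂), ← adj.homEquiv_naturality_left_symm, h',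
      adj.homEquiv_naturality_left_symm]
  · obtain ⟨a, ha⟩ := exists_desc₂ hT b h
    exact ⟨a, ha.symm⟩
  · rintro ⟨a, rfl⟩
    change T.mor₁ ≫ T.mor₂ ≫ a = 0
    rw [comp_distTriang_mor_zero₁₂_assoc _ hT, zero_comp]
  · have := isSplitMono_of_mono (F.map T.mor₁)
    refine ⟨adj.homEquiv _ _ (retraction (F.map T.mor₁) ≫ (adj.homEquiv _ _).symm c), ?_⟩
    apply (adj.homEquiv _ _).symm.injective
    dsimp only
    rw [adj.homEquiv_naturality_left_symm, Equiv.symm_apply_apply, IsSplitMono.id_assoc]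

lemma mono_map_unit (X : K) : Mono (F.map (adj.unit.app X)) :=
  have : IsSplitMono (F.map (adj.unit.app X)) := ⟨⟨_, adj.left_triangle_components X⟩⟩
  inferInstance

lemma inj_FSplit_eq : inj (FSplit F) = addClosure U.essImage := by
  ext I
  constructor
  · intro hI
    obtain ⟨Z, g, h, hT⟩ := (isEMono_FSplit_iff _).2 (mono_map_unit adj I)
    obtain ⟨s, hs⟩ := (hI _ hT).2.2 (𝟙 I)
    exact .summand ⟨adj.unit.app I, s, hs⟩ (.of (U.obj_mem_essImage _))
  · apply addClosure_le_inj
    rintro X ⟨B, ⟨e⟩⟩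
    exact inj_retract (Retract.ofIso e.symm) (inj_rightAdjoint_obj adj B)

lemma enoughInj_FSplit : EnoughInj (FSplit F) := fun X =>
  ⟨_, adj.unit.app X, inj_rightAdjoint_obj adj _, (isEMono_FSplit_iff _).2 (mono_map_unit adj X)⟩

end RightAdjoint

lemma essImage_eq_of_equivalence {V U : L ⥤ K} (W : L ≌ L) (e : W.functor ⋙ V ≅ U) :
    U.essImage = V.essImage := by
  ext X
  constructor
  · rintro ⟨B, ⟨i⟩⟩
    exact ⟨W.functor.obj B, ⟨e.app B ≪≫ i⟩⟩
  · rintro ⟨B, ⟨i⟩⟩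
    exact ⟨W.inverse.obj B, ⟨(e.app _).symm ≪≫ V.mapIso (W.counitIso.app B) ≪≫ i⟩⟩

lemma isFrobeniusClass_FSplit {V U : L ⥤ K} (adjVF : V ⊣ F) (adjFU : F ⊣ U)
    (h : U.essImage = V.essImage) : IsFrobeniusClass (FSplit F) where
  proper := isProperClass_FSplit
  enoughProj := enoughProj_FSplit adjVF
  enoughInj := enoughInj_FSplit adjFU
  proj_eq_inj := by rw [proj_FSplit_eq adjVF, inj_FSplit_eq adjFU, h]

end FSplitTriangles

/-! ### A coherent shift by `ℤ` from an autoequivalence -/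

section ShiftOfEquivalence

variable {C : Type u} [Category.{v} C]

/-- A family of objects indexed by `ℤ` in which each object is identified with the image of the
previous one by a given endofunctor. -/
structure Orbit (S : C ⥤ C) where
  /-- the objects of the family -/
  obj : ℤ → C
  /-- the identification of an object with the image of the previous one -/
  iso : ∀ n, S.obj (obj n) ≅ obj (n + 1)

namespace Orbit

variable {S : C ⥤ C}

/-- The morphisms of families. -/
structure Hom (A B : Orbit S) where
  /-- the components of a morphism -/
  app : ∀ n, A.obj n ⟶ B.obj n
  comm : ∀ n, S.map (app n) ≫ (B.iso n).hom = (A.iso n).hom ≫ app (n + 1)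

instance : Category (Orbit S) where
  Hom := Hom
  id A := ⟨fun _ => 𝟙 _, fun n => by simp⟩
  comp f g := ⟨fun n => f.app n ≫ g.app n, fun n => by
    rw [S.map_comp, assoc, g.comm, ← assoc, f.comm, assoc]⟩
  id_comp f := by cases f; simp
  comp_id f := by cases f; simp
  assoc f g h := by simp

lemma hom_ext {A B : Orbit S} {f g : A ⟶ B} (h : ∀ n, Hom.app f n = Hom.app g n) : f = g := by
  obtain ⟨f, _⟩ := f
  obtain ⟨g, _⟩ := g
  obtain rfl : f = g := funext h
  rfl

@[simp]
lemma comp_app {A B D : Orbit S} (f : A ⟶ B) (g : B ⟶ D) (n : ℤ) :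
    Hom.app (f ≫ g) n = Hom.app f n ≫ Hom.app g n := rfl

/-- The identification of the members of a family with equal indices. -/
abbrev cast (A : Orbit S) {m n : ℤ} (h : m = n) : A.obj m ≅ A.obj n := eqToIso (by rw [h])

lemma app_cast {A B : Orbit S} (f : A ⟶ B) {m n : ℤ} (h : m = n) :
    (A.cast h).hom ≫ Hom.app f n = Hom.app f m ≫ (B.cast h).hom := by
  subst h; simp

lemma iso_cast (A : Orbit S) {m n k : ℤ} (h : m = n) (h₁ : m + 1 = k) (h₂ : k = n + 1) :
    S.map (A.cast h).hom ≫ (A.iso n).hom =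
      (A.iso m ≪≫ A.cast h₁).hom ≫ (A.cast h₂).hom := by
  subst h h₁; simp

lemma iso_cast_cast (A : Orbit S) {m n k l p : ℤ} (h : m = n) (h₁ : m + 1 = k) (h₂ : k = l)
    (h₃ : n + 1 = p) (h₄ : p = l) :
    S.map (A.cast h).hom ≫ ((A.iso n ≪≫ A.cast h₃) ≪≫ A.cast h₄).hom =
      (A.iso m ≪≫ A.cast h₁).hom ≫ (A.cast h₂).hom := by
  subst h h₁ h₂ h₃; simp

/-- An isomorphism of families from its components. -/
def mkIso {A B : Orbit S} (e : ∀ n, A.obj n ≅ B.obj n)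
    (h : ∀ n, S.map (e n).hom ≫ (B.iso n).hom = (A.iso n).hom ≫ (e (n + 1)).hom) : A ≅ B where
  hom := ⟨fun n => (e n).hom, h⟩
  inv := ⟨fun n => (e n).inv, fun n => by
    rw [← cancel_mono (e (n + 1)).hom, assoc, assoc, Iso.inv_hom_id, comp_id, ← h,
      ← S.map_comp_assoc, Iso.inv_hom_id, S.map_id, id_comp]⟩
  hom_inv_id := hom_ext fun n => (e n).hom_inv_id
  inv_hom_id := hom_ext fun n => (e n).inv_hom_id

/-- Translation of the indices. -/
def translate (a : ℤ) : Orbit S ⥤ Orbit S where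
  obj A := ⟨fun n => A.obj (n + a), fun n => A.iso (n + a) ≪≫ A.cast (by abel)⟩
  map {A B} f := ⟨fun n => Hom.app f (n + a), fun n => by
    dsimp only [Iso.trans_hom]
    rw [assoc, app_cast f, ← assoc, ← assoc, Hom.comm]⟩

/-- Translation by zero is the identity. -/
def translateZero : translate (S := S) 0 ≅ 𝟭 _ :=
  NatIso.ofComponents
    (fun A => mkIso (fun n => A.cast (add_zero n)) (fun _ => A.iso_cast _ _ _))
    (fun f => hom_ext fun n => (app_cast f (add_zero n)).symm)

/-- Translations compose. -/
def translateAdd (a b : ℤ) : translate (S := S) (a + b) ≅ translate a ⋙ translate b :=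
  NatIso.ofComponents
    (fun A => mkIso (fun n => A.cast (by abel)) (fun _ => A.iso_cast_cast _ _ _ _ (by abel)))
    (fun f => hom_ext fun n => (app_cast f (by abel)).symm)

lemma eqToHom_app' {a b : ℤ} (h : a = b) {A : Orbit S}
    (h' : (translate a).obj A = (translate b).obj A) (n : ℤ) :
    Hom.app (eqToHom h') n = (A.cast (show n + a = n + b by rw [h])).hom := by
  subst h; rfl

lemma cast_hom_comp (A : Orbit S) {l m n : ℤ} (h : l = m) (h' : m = n) :
    (A.cast h).hom ≫ (A.cast h').hom = (A.cast (h.trans h')).hom := by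
  subst h h'; simp

instance : HasShift (Orbit S) ℤ :=
  hasShiftMk _ _
    { F := translate
      zero := translateZero
      add := translateAdd
      -- All coherence isomorphisms are transports along equalities of indices, so each condition
      -- only compares composites of such transports.
      assoc_hom_app := fun a b c A => hom_ext fun n => by
        have h : n + (a + b + c) = n + c + (a + b) := by abel
        have h' : n + c + (a + b) = n + c + b + a := by abel
        have k : n + (a + (b + c)) = n + (b + c) + a := by abel
        have k' : n + (b + c) + a = n + c + b + a := by abel
        rw [comp_app, comp_app, comp_app, eqToHom_app' (add_assoc a b c)]
        exact (A.cast_hom_comp h h').trans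
          ((A.cast_hom_comp _ _).symm.trans (_ ≫= (A.cast_hom_comp k k').symm))
      zero_add_hom_app := fun a A => hom_ext fun n => by
        have h : n + a = n + a + 0 := by abel
        rw [comp_app, eqToHom_app' (zero_add a)]
        exact (A.cast_hom_comp _ h).symm
      add_zero_hom_app := fun a A => hom_ext fun n => by
        have h : n + a = n + 0 + a := by abel
        rw [comp_app, eqToHom_app' (add_zero a)]
        exact (A.cast_hom_comp _ h).symm }


/-- The functor which evaluates a family at zero. -/
def eval (S : C ⥤ C) : Orbit S ⥤ C where
  obj A := A.obj 0
  map f := Hom.app f 0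

lemma app_succ {A B : Orbit S} (f : A ⟶ B) (n : ℤ) :
    Hom.app f (n + 1) = (A.iso n).inv ≫ S.map (Hom.app f n) ≫ (B.iso n).hom := by
  rw [Hom.comm, Iso.inv_hom_id_assoc]

lemma map_app {A B : Orbit S} (f : A ⟶ B) (n : ℤ) :
    S.map (Hom.app f n) = (A.iso n).hom ≫ Hom.app f (n + 1) ≫ (B.iso n).inv := by
  rw [← reassoc_of% (Hom.comm f n), Iso.hom_inv_id, comp_id]

instance [S.Faithful] : (eval S).Faithful where
  map_injective {A B f g} h := by
    replace h : Hom.app f 0 = Hom.app g 0 := h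
    refine hom_ext fun n => ?_
    induction n using Int.induction_on with
    | zero => exact h
    | succ n ih => rw [app_succ, app_succ, ih]
    | pred n ih =>
      apply S.map_injective
      -- Going down, the component at `-n - 1` is determined after applying `S` by the one at `-n -
      -- 1 + 1`; this index has to be transported to `-n`.
      have e : -(n : ℤ) = -(n : ℤ) - 1 + 1 := by abel
      have h' : Hom.app f (-(n : ℤ) - 1 + 1) = Hom.app g (-(n : ℤ) - 1 + 1) := by
        rw [← cancel_epi (A.cast e).hom, app_cast f e, app_cast g e, ih]
      rw [map_app, map_app, h']

section

variable [S.Full] {A B : Orbit S} (f : A.obj 0 ⟶ B.obj 0)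

/-- The components of the extension of a morphism, for nonnegative indices. -/
def extendNat : ∀ n : ℕ, A.obj n ⟶ B.obj n
  | 0 => f
  | n + 1 => (A.iso n).inv ≫ S.map (extendNat n) ≫ (B.iso n).hom

/-- The components of the extension of a morphism, for negative indices. -/
noncomputable def extendNeg : ∀ n : ℕ, A.obj (Int.negSucc n) ⟶ B.obj (Int.negSucc n)
  | 0 => S.preimage ((A.iso (Int.negSucc 0)).hom ≫ f ≫ (B.iso (Int.negSucc 0)).inv)
  | n + 1 => S.preimage ((A.iso (Int.negSucc (n + 1))).hom ≫ extendNeg n ≫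
      (B.iso (Int.negSucc (n + 1))).inv)

/-- The extension of a morphism between the members of two families at zero. -/
noncomputable def extend : A ⟶ B where
  app
    | .ofNat n => extendNat f n
    | .negSucc n => extendNeg f n
  comm
    | .ofNat n => (Iso.hom_inv_id_assoc (A.iso n) (S.map (extendNat f n) ≫ (B.iso n).hom)).symm
    | .negSucc 0 => by
        change S.map (S.preimage _) ≫ _ = _ ≫ f
        rw [S.map_preimage, assoc, assoc, Iso.inv_hom_id, comp_id]
    | .negSucc (n + 1) => by
        change S.map (S.preimage _) ≫ _ = _ ≫ extendNeg f n
        rw [S.map_preimage, assoc, assoc, Iso.inv_hom_id, comp_id]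

instance : (eval S).Full where
  map_surjective f := ⟨extend f, rfl⟩

end

/-- The members of the family generated by an object, for nonnegative indices. -/
def iterate (S : C ⥤ C) (X : C) : ℕ → C
  | 0 => X
  | n + 1 => S.obj (iterate S X n)

/-- The family generated by an object. -/
def generate (e : C ≌ C) (X : C) : Orbit e.functor where
  obj
    | .ofNat n => iterate e.functor X n
    | .negSucc n => iterate e.inverse X (n + 1)
  iso
    | .ofNat _ => Iso.refl _
    | .negSucc 0 => e.counitIso.app X
    | .negSucc (n + 1) => e.counitIso.app (iterate e.inverse X (n + 1))

instance (e : C ≌ C) : (eval e.functor).EssSurj where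
  mem_essImage X := ⟨generate e X, ⟨Iso.refl _⟩⟩

instance (e : C ≌ C) : (eval e.functor).IsEquivalence where

/-- Translation by one is the given functor. -/
def evalTranslate : translate 1 ⋙ eval S ≅ eval S ⋙ S :=
  NatIso.ofComponents (fun A => (A.iso 0).symm) (fun {A B} f => by
    have h := Hom.comm f 0
    change Hom.app f (0 + 1) ≫ (B.iso 0).inv = (A.iso 0).inv ≫ S.map (Hom.app f 0)
    rw [app_succ, assoc, assoc, Iso.hom_inv_id, comp_id])

end Orbit

section

variable (e : C ≌ C)

/-- The equivalence of a category with the category of families of an autoequivalence. -/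
noncomputable def orbitEquivalence : C ≌ Orbit e.functor :=
  (Orbit.eval e.functor).asEquivalence.symm

/-- The powers of an autoequivalence. -/
noncomputable def shiftOfEquivalence (n : ℤ) : C ⥤ C :=
  (orbitEquivalence e).functor ⋙ shiftFunctor (Orbit e.functor) n ⋙ (orbitEquivalence e).inverse

/-- The shift by `ℤ` given by the powers of an autoequivalence. -/
noncomputable abbrev hasShiftOfEquivalence : HasShift C ℤ :=
  (orbitEquivalence e).fullyFaithfulFunctor.hasShift (shiftOfEquivalence e) fun _ =>
    Functor.associator _ _ _ ≪≫ Functor.isoWhiskerLeft _ (Functor.associator _ _ _ ≪≫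
      Functor.isoWhiskerLeft _ (orbitEquivalence e).counitIso ≪≫ Functor.rightUnitor _)

/-- The shift by one is the given autoequivalence. -/
noncomputable def shiftOfEquivalenceOneIso :
    letI := hasShiftOfEquivalence e
    shiftFunctor C (1 : ℤ) ≅ e.functor :=
  Functor.isoWhiskerLeft (orbitEquivalence e).functor Orbit.evalTranslate ≪≫
    (Functor.associator _ _ _).symm ≪≫
    Functor.isoWhiskerRight (orbitEquivalence e).unitIso.symm e.functor ≪≫ Functor.leftUnitor _

lemma additive_shiftFunctor_of_one [Preadditive C] [HasShift C ℤ]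
    [(shiftFunctor C (1 : ℤ)).Additive] (n : ℤ) : (shiftFunctor C n).Additive := by
  have : (shiftFunctor C (-1 : ℤ)).Additive :=
    have : (shiftEquiv C (1 : ℤ)).functor.Additive :=
      inferInstanceAs (shiftFunctor C (1 : ℤ)).Additive
    (shiftEquiv C (1 : ℤ)).inverse_additive
  induction n using Int.induction_on with
  | zero => exact Functor.additive_of_iso (shiftFunctorZero C ℤ).symm
  | succ n ih => exact Functor.additive_of_iso (shiftFunctorAdd C (n : ℤ) 1).symm
  | pred n ih => exact Functor.additive_of_iso (shiftFunctorAdd C (-n : ℤ) (-1)).symm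

end

end ShiftOfEquivalence

/-! ### Phantom maps and the suspension of the stable category -/

section Stable

variable {K : Type u} [Category.{v} K] [HasZeroObject K] [HasShift K ℤ] [Preadditive K]
  [∀ n : ℤ, (shiftFunctor K n).Additive] [Pretriangulated K]
  {L : Type u'} [Category.{v'} L] [HasZeroObject L] [HasShift L ℤ] [Preadditive L]
  [∀ n : ℤ, (shiftFunctor L n).Additive] [Pretriangulated L]
  {F : K ⥤ L} [F.CommShift ℤ] [F.IsTriangulated]

/-- A phantom is the third map of an `F`-split triangle, so `k` extends along the first map of that
triangle, and consecutive maps compose to zero. -/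
lemma phantom_comp_inj {X Z I : K} {h : Z ⟶ X⟦(1 : ℤ)⟧} (h₀ : F.map h = 0)
    (hI : inj (FSplit F) I) (k : X ⟶ I) : h ≫ k⟦(1 : ℤ)⟧' = 0 := by
  obtain ⟨Y, f, g, hT⟩ := distinguished_cocone_triangle₂ h
  obtain ⟨b, hb⟩ : ∃ b : Y ⟶ I, f ≫ b = k := (hI _ ⟨hT, h₀⟩).2.2 k
  rw [← hb, Functor.map_comp, ← assoc, comp_zero₃₁ hT, zero_comp]

lemma proj_comp_phantom {X Z P : K} {h : Z ⟶ X⟦(1 : ℤ)⟧} (h₀ : F.map h = 0)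
    (hP : proj (FSplit F) P) (k : P ⟶ Z) : k ≫ h = 0 := by
  obtain ⟨Y, f, g, hT⟩ := distinguished_cocone_triangle₂ h
  obtain ⟨b, hb⟩ : ∃ b : P ⟶ Y, b ≫ g = k := (hP _ ⟨hT, h₀⟩).2.2 k
  rw [← hb, assoc, comp_zero₂₃ hT, comp_zero]

variable (F) in
/-- The quotient functor to the `F`-relative stable category. -/
abbrev stab : K ⥤ StableCategory (FSplit F) := stableFunctor (FSplit F)

lemma stab_map_eq_iff {X Y : K} (f g : X ⟶ Y) :
    (stab F).map f = (stab F).map g ↔ IsContractible (FSplit F) (f - g) :=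
  CategoryTheory.Quotient.functor_map_eq_iff _ _ _

lemma comp_phantom_eq_of_stab_map_eq {X Y Z : K} {h : Z ⟶ X⟦(1 : ℤ)⟧} (h₀ : F.map h = 0)
    {f g : Y ⟶ Z} (e : (stab F).map f = (stab F).map g) : f ≫ h = g ≫ h := by
  obtain ⟨P, a, b, hP, hab⟩ := (stab_map_eq_iff f g).1 e
  rw [← sub_eq_zero, ← sub_comp, ← hab, assoc, proj_comp_phantom h₀ hP, comp_zero]

lemma phantom_comp_eq_of_stab_map_eq (hE : proj (FSplit F) = inj (FSplit F)) {X Y Z : K}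
    {h : Z ⟶ X⟦(1 : ℤ)⟧} (h₀ : F.map h = 0) {f g : X ⟶ Y}
    (e : (stab F).map f = (stab F).map g) : h ≫ f⟦(1 : ℤ)⟧' = h ≫ g⟦(1 : ℤ)⟧' := by
  obtain ⟨P, a, b, hP, hab⟩ := (stab_map_eq_iff f g).1 e
  rw [hE] at hP
  rw [← sub_eq_zero, ← comp_sub, ← Functor.map_sub, ← hab, Functor.map_comp, ← assoc,
    phantom_comp_inj h₀ hP, zero_comp]

lemma isZero_stab_obj {P : K} (hP : proj (FSplit F) P) : IsZero ((stab F).obj P) := by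
  rw [IsZero.iff_id_eq_zero, ← (stab F).map_id, ← (stab F).map_zero, stab_map_eq_iff]
  exact ⟨P, 𝟙 P, 𝟙 P, hP, by simp⟩

/-- With zero third map the triangle splits: `ψ` has a section, and the defect of the section from
being a left inverse factors through `J`. -/
lemma isIso_stab_map {J Q X : K} {u : J ⟶ Q} {ψ : Q ⟶ X} {d : X ⟶ J⟦(1 : ℤ)⟧}
    (hT : Triangle.mk u ψ d ∈ distTriang K) (hd : d = 0) (hJ : proj (FSplit F) J) :
    IsIso ((stab F).map ψ) := by
  obtain ⟨s, hs⟩ := exists_lift₃ hT (𝟙 X) (by rw [hd, comp_zero])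
  obtain ⟨a, ha⟩ := exists_lift₂ hT (ψ ≫ s - 𝟙 Q) (by
    rw [sub_comp, assoc, ← hs, comp_id, id_comp, sub_self])
  refine ⟨(stab F).map s, ?_, ?_⟩
  · rw [← (stab F).map_comp, ← (stab F).map_id, stab_map_eq_iff]
    exact ⟨J, a, u, hJ, ha.symm⟩
  · rw [← (stab F).map_comp, ← hs, (stab F).map_id]

section Preenvelope

variable {X I X' : K} {i : X ⟶ I} {p : I ⟶ X'} {α : X' ⟶ X⟦(1 : ℤ)⟧}
  (hT : IsPreenvelopeTriangle (FSplit F) (Triangle.mk i p α))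
include hT

lemma IsPreenvelopeTriangle.dist : Triangle.mk i p α ∈ distTriang K := hT.1.1

lemma IsPreenvelopeTriangle.phantom : F.map α = 0 := hT.1.2

lemma IsPreenvelopeTriangle.inj_obj₂ : inj (FSplit F) I := hT.2

/-- The existence half of the universal property of `α` among phantoms;
`IsPreenvelopeTriangle.stab_map_eq` is uniqueness in the stable category. -/
lemma IsPreenvelopeTriangle.exists_lift {Z : K} {h : Z ⟶ X⟦(1 : ℤ)⟧} (h₀ : F.map h = 0) :
    ∃ c : Z ⟶ X', c ≫ α = h := by
  obtain ⟨c, hc⟩ := exists_lift₁ hT.dist h (phantom_comp_inj h₀ hT.inj_obj₂ i)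
  exact ⟨c, hc.symm⟩

lemma IsPreenvelopeTriangle.stab_map_eq (hE : proj (FSplit F) = inj (FSplit F)) {Z : K}
    {c c' : Z ⟶ X'} (h : c ≫ α = c' ≫ α) : (stab F).map c = (stab F).map c' := by
  obtain ⟨q, hq⟩ := exists_lift₃ hT.dist (c - c') (by rw [sub_comp, h, sub_self])
  exact (stab_map_eq_iff c c').2 ⟨I, q, p, by rw [hE]; exact hT.inj_obj₂, hq.symm⟩

lemma IsPreenvelopeTriangle.exists_map {Y J Y' : K} {j : Y ⟶ J} {q : J ⟶ Y'}
    {β : Y' ⟶ Y⟦(1 : ℤ)⟧} (hT' : IsPreenvelopeTriangle (FSplit F) (Triangle.mk j q β))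
    (f : X ⟶ Y) : ∃ c : X' ⟶ Y', c ≫ β = α ≫ f⟦(1 : ℤ)⟧' :=
  hT'.exists_lift (by rw [F.map_comp, hT.phantom, zero_comp])

end Preenvelope

/-- The cofibre and `α` are quantified before the rest because the universal property involves only
these two; the chosen suspension retains nothing else. -/
lemma exists_preenvelope (hE : EnoughInj (FSplit F)) (X : K) :
    ∃ (X' : K) (α : X' ⟶ X⟦(1 : ℤ)⟧) (I : K) (i : X ⟶ I) (p : I ⟶ X'),
      IsPreenvelopeTriangle (FSplit F) (Triangle.mk i p α) := by
  obtain ⟨I, i, hI, X', p, α, hT⟩ := hE X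
  exact ⟨X', α, I, i, p, hT, hI⟩

section Suspension

variable (hE : IsFrobeniusClass (FSplit F))

/-- The cofibre of an injective preenvelope. -/
noncomputable def cosyzygy (X : K) : K := (exists_preenvelope hE.enoughInj X).choose

/-- The third map of the triangle of an injective preenvelope. -/
noncomputable def cosyzygyMap (X : K) : cosyzygy hE X ⟶ X⟦(1 : ℤ)⟧ :=
  (exists_preenvelope hE.enoughInj X).choose_spec.choose

lemma exists_cosyzygy_triangle (X : K) : ∃ (I : K) (i : X ⟶ I) (p : I ⟶ cosyzygy hE X),
    IsPreenvelopeTriangle (FSplit F) (Triangle.mk i p (cosyzygyMap hE X)) :=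
  (exists_preenvelope hE.enoughInj X).choose_spec.choose_spec

lemma map_cosyzygyMap (X : K) : F.map (cosyzygyMap hE X) = 0 := by
  obtain ⟨I, i, p, hT⟩ := exists_cosyzygy_triangle hE X
  exact hT.phantom

lemma exists_cosyzygy_lift {X Z : K} {h : Z ⟶ X⟦(1 : ℤ)⟧} (h₀ : F.map h = 0) :
    ∃ c : Z ⟶ cosyzygy hE X, c ≫ cosyzygyMap hE X = h := by
  obtain ⟨I, i, p, hT⟩ := exists_cosyzygy_triangle hE X
  exact hT.exists_lift h₀

lemma stab_map_eq_of_cosyzygyMap {X Z : K} {c c' : Z ⟶ cosyzygy hE X}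
    (h : c ≫ cosyzygyMap hE X = c' ≫ cosyzygyMap hE X) : (stab F).map c = (stab F).map c' := by
  obtain ⟨I, i, p, hT⟩ := exists_cosyzygy_triangle hE X
  exact hT.stab_map_eq hE.proj_eq_inj h

/-- The class of phantom maps to a suspension, as morphisms in the stable category. -/
noncomputable def phantomLift {X Z : K} {h : Z ⟶ X⟦(1 : ℤ)⟧} (h₀ : F.map h = 0) :
    (stab F).obj Z ⟶ (stab F).obj (cosyzygy hE X) :=
  (stab F).map (exists_cosyzygy_lift hE h₀).choose

lemma phantomLift_eq {X Z : K} {h : Z ⟶ X⟦(1 : ℤ)⟧} (h₀ : F.map h = 0) {c : Z ⟶ cosyzygy hE X}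
    (hc : c ≫ cosyzygyMap hE X = h) : phantomLift hE h₀ = (stab F).map c :=
  stab_map_eq_of_cosyzygyMap hE ((exists_cosyzygy_lift hE h₀).choose_spec.trans hc.symm)

lemma map_cosyzygyMap_comp {X Y : K} (f : X ⟶ Y) :
    F.map (cosyzygyMap hE X ≫ f⟦(1 : ℤ)⟧') = 0 := by
  rw [F.map_comp, map_cosyzygyMap, zero_comp]

/-- The suspension, as a functor defined on the triangulated category. -/
noncomputable def preSuspension : K ⥤ StableCategory (FSplit F) where
  obj X := (stab F).obj (cosyzygy hE X)
  map f := phantomLift hE (map_cosyzygyMap_comp hE f)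
  map_id X := by
    rw [← (stab F).map_id]
    exact phantomLift_eq hE _ (by simp)
  map_comp {X Y Z} f g := by
    obtain ⟨c, hc⟩ := exists_cosyzygy_lift hE (map_cosyzygyMap_comp hE f)
    obtain ⟨d, hd⟩ := exists_cosyzygy_lift hE (map_cosyzygyMap_comp hE g)
    rw [phantomLift_eq hE _ hc, phantomLift_eq hE _ hd, ← (stab F).map_comp]
    exact phantomLift_eq hE _ (by rw [assoc, hd, reassoc_of% hc, Functor.map_comp])

/-- The suspension of the stable category. -/
noncomputable def suspension : StableCategory (FSplit F) ⥤ StableCategory (FSplit F) :=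
  CategoryTheory.Quotient.lift _ (preSuspension hE) fun X Y f g h => by
    obtain ⟨c, hc⟩ := exists_cosyzygy_lift hE (map_cosyzygyMap_comp hE f)
    refine (phantomLift_eq hE (map_cosyzygyMap_comp hE f) hc).trans
      (phantomLift_eq hE (map_cosyzygyMap_comp hE g) (hc.trans ?_)).symm
    exact phantom_comp_eq_of_stab_map_eq hE.proj_eq_inj (map_cosyzygyMap hE X)
      ((stab_map_eq_iff f g).2 h)

lemma suspension_map_eq {X Y : K} (f : X ⟶ Y) {c : cosyzygy hE X ⟶ cosyzygy hE Y}
    (hc : c ≫ cosyzygyMap hE Y = cosyzygyMap hE X ≫ f⟦(1 : ℤ)⟧') :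
    (suspension hE).map ((stab F).map f) = (stab F).map c :=
  phantomLift_eq hE (map_cosyzygyMap_comp hE f) hc

instance : (suspension hE).Additive where
  map_add {X Y a b} := by
    obtain ⟨f, rfl⟩ := (stab F).map_surjective (X := X.as) (Y := Y.as) a
    obtain ⟨g, rfl⟩ := (stab F).map_surjective (X := X.as) (Y := Y.as) b
    obtain ⟨c, hc⟩ := exists_cosyzygy_lift hE (map_cosyzygyMap_comp hE f)
    obtain ⟨d, hd⟩ := exists_cosyzygy_lift hE (map_cosyzygyMap_comp hE g)
    rw [suspension_map_eq hE f hc, suspension_map_eq hE g hd, ← (stab F).map_add,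
      suspension_map_eq hE (f + g) (c := c + d)
        (by rw [add_comp, hc, hd, Functor.map_add, comp_add])]
    exact (stab F).map_add

instance : (suspension hE).Full where
  map_surjective {X Y} a := by
    obtain ⟨c, rfl⟩ := (stab F).map_surjective (X := cosyzygy hE X.as) (Y := cosyzygy hE Y.as) a
    obtain ⟨I, i, p, hT⟩ := exists_cosyzygy_triangle hE X.as
    have h₀ : F.map (c ≫ cosyzygyMap hE Y.as) = 0 := by
      rw [F.map_comp, map_cosyzygyMap, comp_zero]
    -- The injective `I` is also projective, so the phantom vanishes on `p` and factors through
    -- `X⟦1⟧`. Desuspending the factor gives the preimage.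
    obtain ⟨k, hk⟩ := exists_desc₃ hT.dist (c ≫ cosyzygyMap hE Y.as)
      (proj_comp_phantom h₀ (by rw [hE.proj_eq_inj]; exact hT.inj_obj₂) p)
    obtain ⟨f, rfl⟩ := (shiftFunctor K (1 : ℤ)).map_surjective k
    exact ⟨(stab F).map f, suspension_map_eq hE f hk⟩

instance : (suspension hE).Faithful where
  map_injective {X Y a b} h := by
    obtain ⟨f, rfl⟩ := (stab F).map_surjective (X := X.as) (Y := Y.as) a
    obtain ⟨g, rfl⟩ := (stab F).map_surjective (X := X.as) (Y := Y.as) b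
    obtain ⟨c, hc⟩ := exists_cosyzygy_lift hE (map_cosyzygyMap_comp hE f)
    obtain ⟨d, hd⟩ := exists_cosyzygy_lift hE (map_cosyzygyMap_comp hE g)
    rw [suspension_map_eq hE f hc, suspension_map_eq hE g hd] at h
    have h' := comp_phantom_eq_of_stab_map_eq (map_cosyzygyMap hE Y.as) h
    rw [hc, hd] at h'
    obtain ⟨I, i, p, hT⟩ := exists_cosyzygy_triangle hE X.as
    -- The shifted difference is killed by the third map of the preenvelope triangle, so it factors
    -- through `-i⟦1⟧'`, the next map of the twice rotated triangle. Hence `f - g` factors through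
    -- `I`, with the sign put into `-m`.
    obtain ⟨k, hk⟩ := exists_desc₂ (rotate_distinguished_iff.1 (rotate_distinguished_iff.1 hT.dist))
      ((f - g)⟦(1 : ℤ)⟧') (by rw [Functor.map_sub, comp_sub, h', sub_self])
    obtain ⟨m, rfl⟩ := (shiftFunctor K (1 : ℤ)).map_surjective k
    refine (stab_map_eq_iff f g).2 ⟨I, i, -m, by rw [hE.proj_eq_inj]; exact hT.inj_obj₂, ?_⟩
    apply (shiftFunctor K (1 : ℤ)).map_injective
    rw [hk, Functor.map_comp, Functor.map_neg, comp_neg, neg_comp]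

/-- The comparison of the cofibres of two preenvelopes. -/
noncomputable def cofibreIsoCosyzygy {X I X' : K} {i : X ⟶ I} {p : I ⟶ X'} {α : X' ⟶ X⟦(1 : ℤ)⟧}
    (hT : IsPreenvelopeTriangle (FSplit F) (Triangle.mk i p α)) :
    (stab F).obj X' ≅ (stab F).obj (cosyzygy hE X) where
  hom := phantomLift hE hT.phantom
  inv := (stab F).map (hT.exists_lift (map_cosyzygyMap hE X)).choose
  hom_inv_id := by
    obtain ⟨c, hc⟩ := exists_cosyzygy_lift hE hT.phantom
    have hd := (hT.exists_lift (map_cosyzygyMap hE X)).choose_spec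
    rw [phantomLift_eq hE _ hc, ← (stab F).map_comp, ← (stab F).map_id]
    exact hT.stab_map_eq hE.proj_eq_inj (by rw [assoc, hd, hc, id_comp])
  inv_hom_id := by
    obtain ⟨c, hc⟩ := exists_cosyzygy_lift hE hT.phantom
    have hd := (hT.exists_lift (map_cosyzygyMap hE X)).choose_spec
    rw [phantomLift_eq hE _ hc, ← (stab F).map_comp]
    exact (stab_map_eq_of_cosyzygyMap hE (by rw [assoc, hc, hd, id_comp])).trans
      ((stab F).map_id _)

/-- The comparison of the cofibre of a preenvelope with the suspension. -/
noncomputable def cofibreIso {X I X' : K} {i : X ⟶ I} {p : I ⟶ X'} {α : X' ⟶ X⟦(1 : ℤ)⟧}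
    (hT : IsPreenvelopeTriangle (FSplit F) (Triangle.mk i p α)) :
    (stab F).obj X' ≅ (suspension hE).obj ((stab F).obj X) :=
  cofibreIsoCosyzygy hE hT

lemma cofibreIso_naturality {X I X' Y J Y' : K} {i : X ⟶ I} {p : I ⟶ X'}
    {α : X' ⟶ X⟦(1 : ℤ)⟧} (hT : IsPreenvelopeTriangle (FSplit F) (Triangle.mk i p α))
    {j : Y ⟶ J} {q : J ⟶ Y'} {β : Y' ⟶ Y⟦(1 : ℤ)⟧}
    (hT' : IsPreenvelopeTriangle (FSplit F) (Triangle.mk j q β)) (f : X ⟶ Y) (c : X' ⟶ Y')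
    (w : c ≫ β = α ≫ f⟦(1 : ℤ)⟧') :
    (stab F).map c ≫ (cofibreIso hE hT').hom =
      (cofibreIso hE hT).hom ≫ (suspension hE).map ((stab F).map f) := by
  obtain ⟨a, ha⟩ := exists_cosyzygy_lift hE hT.phantom
  obtain ⟨b, hb⟩ := exists_cosyzygy_lift hE hT'.phantom
  obtain ⟨d, hd⟩ := exists_cosyzygy_lift hE (map_cosyzygyMap_comp hE f)
  rw [suspension_map_eq hE f hd]
  change (stab F).map c ≫ phantomLift hE hT'.phantom = phantomLift hE hT.phantom ≫ _
  rw [phantomLift_eq hE _ ha, phantomLift_eq hE _ hb, ← (stab F).map_comp, ← (stab F).map_comp]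
  exact stab_map_eq_of_cosyzygyMap hE (by rw [assoc, assoc, hb, hd, w, reassoc_of% ha])

include hE in
lemma exists_projective_preenvelope (Z : K) :
    ∃ (Z' P : K) (r : Z' ⟶ P) (s : P ⟶ Z) (ζ : Z ⟶ Z'⟦(1 : ℤ)⟧),
      IsPreenvelopeTriangle (FSplit F) (Triangle.mk r s ζ) := by
  obtain ⟨P, s, hP, Z', r, ζ, hT⟩ := hE.enoughProj Z
  rw [hE.proj_eq_inj] at hP
  exact ⟨Z', P, r, s, ζ, hT, hP⟩

instance : (suspension hE).EssSurj where
  mem_essImage Z := by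
    -- A triangle of a projective cover is also a preenvelope triangle of its first object, so `Z`
    -- is the suspension of `Z'`.
    obtain ⟨Z', P, r, s, ζ, hT⟩ := exists_projective_preenvelope hE Z.as
    exact ⟨(stab F).obj Z', ⟨(cofibreIso hE hT).symm⟩⟩

instance : (suspension hE).IsEquivalence where

/-- The identification of a shift on the stable category with the suspension, from an isomorphism
of functors. -/
noncomputable def suspensionIsoOfIso [HasShift (StableCategory (FSplit F)) ℤ]
    (θ : shiftFunctor (StableCategory (FSplit F)) (1 : ℤ) ≅ suspension hE) :
    SuspensionIso (FSplit F) where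
  iso _ hT := cofibreIso hE hT ≪≫ (θ.app _).symm
  naturality T T' hT hT' φ := by
    have h := cofibreIso_naturality hE hT hT' φ.hom₁ φ.hom₃ φ.comm₃.symm
    have h' := θ.inv.naturality ((stab F).map φ.hom₁)
    rw [Iso.trans_hom, Iso.trans_hom, ← assoc]
    refine (congrArg (· ≫ _) h).trans ?_
    rw [assoc, assoc]
    exact congrArg ((cofibreIso hE hT).hom ≫ ·) h'

end Suspension

end Stable

section

variable {C : Type u} [Category.{v} C] [HasShift C ℤ] {X Y Z X' Y' Z' : C} {f : X ⟶ Y} {g : Y ⟶ Z}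
  {h : Z ⟶ X⟦(1 : ℤ)⟧} {f' : X' ⟶ Y'} {g' : Y' ⟶ Z'} {h' : Z' ⟶ X'⟦(1 : ℤ)⟧}

/-- An isomorphism of triangles from its components. -/
def triangleIso (a : X ≅ X') (b : Y ≅ Y') (c : Z ≅ Z') (w₁ : f ≫ b.hom = a.hom ≫ f')
    (w₂ : g ≫ c.hom = b.hom ≫ g') (w₃ : h ≫ a.hom⟦(1 : ℤ)⟧' = c.hom ≫ h') :
    Triangle.mk f g h ≅ Triangle.mk f' g' h' :=
  Triangle.isoMk _ _ a b c w₁ w₂ w₃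

/-- An isomorphism of triangles which is the identity on the first two objects. -/
def triangleIsoOfIso₃ {f : X ⟶ Y} {g : Y ⟶ Z} {h : Z ⟶ X⟦(1 : ℤ)⟧} {g' : Y ⟶ Z'}
    {h' : Z' ⟶ X⟦(1 : ℤ)⟧} (c : Z ≅ Z') (w₂ : g ≫ c.hom = g') (w₃ : h = c.hom ≫ h') :
    Triangle.mk f g h ≅ Triangle.mk f g' h' :=
  triangleIso (Iso.refl _) (Iso.refl _) c (by simp) (by simpa using w₂) (by simpa using w₃)

lemma exists_hom₃_of_iso {D₁ D₂ S₁ S₂ : Triangle C} (e : D₁ ≅ S₁) (e₂ : D₂ ≅ S₂)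
    (H : ∀ (a : S₁.obj₁ ⟶ S₂.obj₁) (b : S₁.obj₂ ⟶ S₂.obj₂), S₁.mor₁ ≫ b = a ≫ S₂.mor₁ →
      ∃ c : S₁.obj₃ ⟶ S₂.obj₃, S₁.mor₂ ≫ c = b ≫ S₂.mor₂ ∧
        S₁.mor₃ ≫ a⟦(1 : ℤ)⟧' = c ≫ S₂.mor₃)
    (a : D₁.obj₁ ⟶ D₂.obj₁) (b : D₁.obj₂ ⟶ D₂.obj₂) (w : D₁.mor₁ ≫ b = a ≫ D₂.mor₁) :
    ∃ c : D₁.obj₃ ⟶ D₂.obj₃, D₁.mor₂ ≫ c = b ≫ D₂.mor₂ ∧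
      D₁.mor₃ ≫ a⟦(1 : ℤ)⟧' = c ≫ D₂.mor₃ := by
  obtain ⟨c, hc₁, hc₂⟩ := H (e.inv.hom₁ ≫ a ≫ e₂.hom.hom₁) (e.inv.hom₂ ≫ b ≫ e₂.hom.hom₂) (by
    rw [e.inv.comm₁_assoc, reassoc_of% w, e₂.hom.comm₁, assoc, assoc])
  refine ⟨e.hom.hom₃ ≫ c ≫ e₂.inv.hom₃, ?_, ?_⟩
  · rw [e.hom.comm₂_assoc, reassoc_of% hc₁, e₂.inv.comm₂, e.hom_inv_id_triangle_hom₂_assoc,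
      e₂.hom_inv_id_triangle_hom₂_assoc]
  · rw [assoc, assoc, ← e₂.inv.comm₃, ← reassoc_of% hc₂, ← e.hom.comm₃_assoc, ← Functor.map_comp,
      ← Functor.map_comp, assoc, assoc, e₂.hom_inv_id_triangle_hom₁, comp_id,
      e.hom_inv_id_triangle_hom₁_assoc]

end

section

variable {C : Type u} [Category.{v} C] [HasZeroObject C] [HasShift C ℤ] [Preadditive C]
  [∀ n : ℤ, (shiftFunctor C n).Additive] [Pretriangulated C]

lemma exists_iso_of_distinguished {Y Z Z₀ X' : C} {g : Y ⟶ Z} {h : Z ⟶ X'}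
    {e : X' ⟶ Y⟦(1 : ℤ)⟧} {g₀ : Y ⟶ Z₀} {h₀ : Z₀ ⟶ X'} (hT : Triangle.mk g h e ∈ distTriang C)
    (hT₀ : Triangle.mk g₀ h₀ e ∈ distTriang C) :
    ∃ w : Z ≅ Z₀, g ≫ w.hom = g₀ ∧ w.hom ≫ h₀ = h := by
  obtain ⟨w, hw₁, hw₂⟩ := exists_hom₂ hT hT₀ (𝟙 Y) (𝟙 X') (by simp)
  let φ : Triangle.mk g h e ⟶ Triangle.mk g₀ h₀ e :=
    Triangle.homMk _ _ (𝟙 Y) w (𝟙 X') hw₁ hw₂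
      (show e ≫ (𝟙 Y)⟦(1 : ℤ)⟧' = 𝟙 X' ≫ e by simp)
  have : IsIso w := isIso₂_of_isIso₁₃ φ hT hT₀ (show IsIso (𝟙 Y) by infer_instance)
    (show IsIso (𝟙 X') by infer_instance)
  exact ⟨asIso w, by simpa using hw₁, by simpa using hw₂.symm⟩

lemma homotopyPushout_swap {X Y I Z : C} {f : X ⟶ Y} {i : X ⟶ I} {g : Y ⟶ Z} {u : I ⟶ Z}
    {d : Z ⟶ X⟦(1 : ℤ)⟧}
    (hd : Triangle.mk (biprod.lift f i) (biprod.desc g (-u)) d ∈ distTriang C) :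
    Triangle.mk (biprod.lift i f) (biprod.desc u (-g)) (-d) ∈ distTriang C :=
  distinguished_of_iso hd (Iso.refl _) (biprod.braiding _ _) (-Iso.refl _)
    (by ext <;> simp) (by ext <;> simp) (by simp)

end

/-! ### Standard triangles: cones and completion of morphisms -/

section Triangulation

variable {K : Type u} [Category.{v} K] [HasZeroObject K] [HasShift K ℤ] [Preadditive K]
  [∀ n : ℤ, (shiftFunctor K n).Additive] [Pretriangulated K]
  {L : Type u'} [Category.{v'} L] [HasZeroObject L] [HasShift L ℤ] [Preadditive L]
  [∀ n : ℤ, (shiftFunctor L n).Additive] [Pretriangulated L]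
  {F : K ⥤ L} [F.CommShift ℤ] [F.IsTriangulated]
  [HasShift (StableCategory (FSplit F)) ℤ] (σ : SuspensionIso (FSplit F))

/-- The identification of the cofibre of a preenvelope with the suspension. -/
def suspIso {X I X' : K} {i : X ⟶ I} {p : I ⟶ X'} {α : X' ⟶ X⟦(1 : ℤ)⟧}
    (hT : IsPreenvelopeTriangle (FSplit F) (Triangle.mk i p α)) :
    (stab F).obj X' ≅ ((stab F).obj X)⟦(1 : ℤ)⟧ :=
  σ.iso _ hT

lemma suspIso_naturality {X I X' Y J Y' : K} {i : X ⟶ I} {p : I ⟶ X'}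
    {α : X' ⟶ X⟦(1 : ℤ)⟧} (hT : IsPreenvelopeTriangle (FSplit F) (Triangle.mk i p α))
    {j : Y ⟶ J} {q : J ⟶ Y'} {β : Y' ⟶ Y⟦(1 : ℤ)⟧}
    (hT' : IsPreenvelopeTriangle (FSplit F) (Triangle.mk j q β)) (f : X ⟶ Y) (c : X' ⟶ Y')
    (w : c ≫ β = α ≫ f⟦(1 : ℤ)⟧') :
    (stab F).map c ≫ (suspIso σ hT').hom =
      (suspIso σ hT).hom ≫ ((stab F).map f)⟦(1 : ℤ)⟧' := by
  obtain ⟨b, hb₁, hb₂⟩ := exists_hom₂ hT.dist hT'.dist f c w.symm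
  exact σ.naturality _ _ hT hT' ⟨f, b, c, hb₁, hb₂, w.symm⟩

/-- The triangle of the stable category given by a preenvelope triangle, a morphism and a
cone of its composition with the third map of the preenvelope triangle. -/
abbrev stableTriangle {X I X' : K} {i : X ⟶ I} {p : I ⟶ X'} {α : X' ⟶ X⟦(1 : ℤ)⟧}
    (hT : IsPreenvelopeTriangle (FSplit F) (Triangle.mk i p α)) {Y Z : K} (f : X ⟶ Y) (g : Y ⟶ Z)
    (h : Z ⟶ X') : Triangle (StableCategory (FSplit F)) :=
  Triangle.mk ((stab F).map f) ((stab F).map g) ((stab F).map h ≫ (suspIso σ hT).hom)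

/-- The triangles isomorphic to the ones given by a preenvelope triangle and a morphism. -/
def IsStableTriangle (D : Triangle (StableCategory (FSplit F))) : Prop :=
  ∃ (X I X' : K) (i : X ⟶ I) (p : I ⟶ X') (α : X' ⟶ X⟦(1 : ℤ)⟧)
    (hT : IsPreenvelopeTriangle (FSplit F) (Triangle.mk i p α)) (Y Z : K) (f : X ⟶ Y)
    (g : Y ⟶ Z) (h : Z ⟶ X'), Triangle.mk g h (α ≫ f⟦(1 : ℤ)⟧') ∈ distTriang K ∧
      Nonempty (D ≅ stableTriangle σ hT f g h)

variable {σ}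

lemma IsStableTriangle.of_iso {D D' : Triangle (StableCategory (FSplit F))}
    (hD : IsStableTriangle σ D) (e : D' ≅ D) : IsStableTriangle σ D' := by
  obtain ⟨X, I, X', i, p, α, hT, Y, Z, f, g, h, hd, ⟨e'⟩⟩ := hD
  exact ⟨X, I, X', i, p, α, hT, Y, Z, f, g, h, hd, ⟨e ≪≫ e'⟩⟩

lemma isStableTriangle_stableTriangle {X I X' : K} {i : X ⟶ I} {p : I ⟶ X'}
    {α : X' ⟶ X⟦(1 : ℤ)⟧} (hT : IsPreenvelopeTriangle (FSplit F) (Triangle.mk i p α)) {Y Z : K}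
    {f : X ⟶ Y} {g : Y ⟶ Z} {h : Z ⟶ X'} (hd : Triangle.mk g h (α ≫ f⟦(1 : ℤ)⟧') ∈ distTriang K) :
    IsStableTriangle σ (stableTriangle σ hT f g h) :=
  ⟨X, I, X', i, p, α, hT, Y, Z, f, g, h, hd, ⟨Iso.refl _⟩⟩

/-- The homotopy pushout of `(f, i)` fits into a triangle with the same third map `α ≫ f⟦1⟧'`, so it
is isomorphic to `Z` compatibly with the maps from `Y` and to `X'`. -/
lemma IsStableTriangle.exists_pushout [IsTriangulated K]
    {D : Triangle (StableCategory (FSplit F))} (hD : IsStableTriangle σ D) :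
    ∃ (X I X' : K) (i : X ⟶ I) (p : I ⟶ X') (α : X' ⟶ X⟦(1 : ℤ)⟧)
      (hT : IsPreenvelopeTriangle (FSplit F) (Triangle.mk i p α)) (Y Z : K) (f : X ⟶ Y)
      (g : Y ⟶ Z) (u : I ⟶ Z) (h : Z ⟶ X'),
      Triangle.mk (biprod.lift f i) (biprod.desc g (-u)) (-(h ≫ α)) ∈ distTriang K ∧ u ≫ h = p ∧
      Triangle.mk g h (α ≫ f⟦(1 : ℤ)⟧') ∈ distTriang K ∧
      Nonempty (D ≅ stableTriangle σ hT f g h) := by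
  obtain ⟨X, I, X', i, p, α, hT, Y, Z, f, g, h, hd, ⟨e⟩⟩ := hD
  obtain ⟨Z₀, g₀, u₀, d₀, hd₀⟩ := exists_homotopyPushout f i
  obtain ⟨h₀, hu₀, hh₀, rfl⟩ := exists_cofibre_of_homotopyPushout hd₀ hT.dist
  obtain ⟨w, hw₁, hw₂⟩ := exists_iso_of_distinguished hd hh₀
  refine ⟨X, I, X', i, p, α, hT, Y, Z₀, f, g₀, u₀, h₀, hd₀, hu₀, hh₀,
    ⟨e ≪≫ triangleIsoOfIso₃ ((stab F).mapIso w) ?_ ?_⟩⟩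
  · rw [Functor.mapIso_hom, ← Functor.map_comp, hw₁]
  · rw [Functor.mapIso_hom, ← assoc, ← Functor.map_comp, hw₂]

lemma isStandardTriangle_iff [IsTriangulated K] (D : Triangle (StableCategory (FSplit F))) :
    IsStandardTriangle σ D ↔ IsStableTriangle σ D := by
  constructor
  · rintro ⟨T, hT, Y, Z, f, g, u, h, -, -, hd, e⟩
    exact ⟨_, _, _, _, _, _, hT, Y, Z, f, g, h, hd, e⟩
  · intro hD
    obtain ⟨X, I, X', i, p, α, hT, Y, Z, f, g, u, h, hc, hu, hd, e⟩ := hD.exists_pushout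
    exact ⟨_, hT, Y, Z, f, g, u, h, ⟨_, hc⟩, hu, hd, e⟩

section

variable (hE : IsFrobeniusClass (FSplit F))
include hE

lemma isStableTriangle_contractible (X : StableCategory (FSplit F)) :
    IsStableTriangle σ (contractibleTriangle X) := by
  obtain ⟨X', α, I, i, p, hT⟩ := exists_preenvelope hE.enoughInj X.as
  have hI : IsZero ((stab F).obj I) :=
    isZero_stab_obj (by rw [hE.proj_eq_inj]; exact hT.inj_obj₂)
  refine ⟨X.as, I, X', i, p, α, hT, X.as, I, 𝟙 _, i, p, ?_, ⟨?_⟩⟩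
  · rw [CategoryTheory.Functor.map_id, comp_id]
    exact hT.dist
  · refine triangleIso (Iso.refl _) (Iso.refl _) ((isZero_zero _).iso hI) ?_ (hI.eq_of_tgt _ _)
      ((isZero_zero _).eq_of_src _ _)
    exact congrArg (𝟙 X ≫ ·) ((stab F).map_id X.as).symm

lemma exists_isStableTriangle {X Y : StableCategory (FSplit F)} (a : X ⟶ Y) :
    ∃ (Z : StableCategory (FSplit F)) (b : Y ⟶ Z) (c : Z ⟶ X⟦(1 : ℤ)⟧),
      IsStableTriangle σ (Triangle.mk a b c) := by
  obtain ⟨f, rfl⟩ := (stab F).map_surjective (X := X.as) (Y := Y.as) a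
  obtain ⟨X', α, I, i, p, hT⟩ := exists_preenvelope hE.enoughInj X.as
  obtain ⟨Z, g, h, hd⟩ := distinguished_cocone_triangle₂ (α ≫ f⟦(1 : ℤ)⟧')
  exact ⟨_, _, _, isStableTriangle_stableTriangle hT hd⟩

lemma exists_hom₃_stableTriangle {X I X' : K} {i : X ⟶ I} {p : I ⟶ X'}
    {α : X' ⟶ X⟦(1 : ℤ)⟧} (hT : IsPreenvelopeTriangle (FSplit F) (Triangle.mk i p α)) {Y Z : K}
    {f : X ⟶ Y} {g : Y ⟶ Z} {h : Z ⟶ X'} (hd : Triangle.mk g h (α ≫ f⟦(1 : ℤ)⟧') ∈ distTriang K)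
    {X₂ I₂ X₂' : K} {i₂ : X₂ ⟶ I₂} {p₂ : I₂ ⟶ X₂'}
    {α₂ : X₂' ⟶ X₂⟦(1 : ℤ)⟧} (hT₂ : IsPreenvelopeTriangle (FSplit F) (Triangle.mk i₂ p₂ α₂))
    {Y₂ Z₂ : K} {f₂ : X₂ ⟶ Y₂} {g₂ : Y₂ ⟶ Z₂} {h₂ : Z₂ ⟶ X₂'}
    (hd₂ : Triangle.mk g₂ h₂ (α₂ ≫ f₂⟦(1 : ℤ)⟧') ∈ distTriang K)
    (a : (stab F).obj X ⟶ (stab F).obj X₂) (b : (stab F).obj Y ⟶ (stab F).obj Y₂)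
    (w : (stab F).map f ≫ b = a ≫ (stab F).map f₂) :
    ∃ c : (stab F).obj Z ⟶ (stab F).obj Z₂, (stab F).map g ≫ c = b ≫ (stab F).map g₂ ∧
      ((stab F).map h ≫ (suspIso σ hT).hom) ≫ a⟦(1 : ℤ)⟧' =
        c ≫ (stab F).map h₂ ≫ (suspIso σ hT₂).hom := by
  obtain ⟨a, rfl⟩ := (stab F).map_surjective a
  obtain ⟨b, rfl⟩ := (stab F).map_surjective b
  rw [← Functor.map_comp, ← Functor.map_comp] at w
  -- The square commutes only modulo maps through projectives, but composition with `α` removes the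
  -- error. The resulting square in `K` commutes strictly and can be completed there.
  have w' := phantom_comp_eq_of_stab_map_eq hE.proj_eq_inj hT.phantom w
  rw [Functor.map_comp, Functor.map_comp] at w'
  obtain ⟨a', ha'⟩ := hT.exists_map hT₂ a
  obtain ⟨m, hm₁, hm₂⟩ := exists_hom₂ hd hd₂ b a' (by rw [assoc, w', reassoc_of% ha'])
  refine ⟨(stab F).map m, ?_, ?_⟩
  · rw [← Functor.map_comp, hm₁, Functor.map_comp]
  · rw [assoc, ← suspIso_naturality σ hT hT₂ a a' ha', ← assoc, ← assoc, ← Functor.map_comp,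
      ← Functor.map_comp, hm₂]

lemma exists_hom₃_of_isStableTriangle {D₁ D₂ : Triangle (StableCategory (FSplit F))}
    (h₁ : IsStableTriangle σ D₁) (h₂ : IsStableTriangle σ D₂) (a : D₁.obj₁ ⟶ D₂.obj₁)
    (b : D₁.obj₂ ⟶ D₂.obj₂) (w : D₁.mor₁ ≫ b = a ≫ D₂.mor₁) :
    ∃ c : D₁.obj₃ ⟶ D₂.obj₃, D₁.mor₂ ≫ c = b ≫ D₂.mor₂ ∧
      D₁.mor₃ ≫ a⟦(1 : ℤ)⟧' = c ≫ D₂.mor₃ := by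
  obtain ⟨X, I, X', i, p, α, hT, Y, Z, f, g, h, hd, ⟨e⟩⟩ := h₁
  obtain ⟨X₂, I₂, X₂', i₂, p₂, α₂, hT₂, Y₂, Z₂, f₂, g₂, h₂, hd₂, ⟨e₂⟩⟩ := h₂
  exact exists_hom₃_of_iso e e₂ (exists_hom₃_stableTriangle hE hT hd hT₂ hd₂) a b w

end

end Triangulation

/-! ### Rotation and the octahedral axiom -/

section Triangulation

variable {K : Type u} [Category.{v} K] [HasZeroObject K] [HasShift K ℤ] [Preadditive K]
  [∀ n : ℤ, (shiftFunctor K n).Additive] [Pretriangulated K] [IsTriangulated K]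
  {L : Type u'} [Category.{v'} L] [HasZeroObject L] [HasShift L ℤ] [Preadditive L]
  [∀ n : ℤ, (shiftFunctor L n).Additive] [Pretriangulated L]
  {F : K ⥤ L} [F.CommShift ℤ] [F.IsTriangulated]

/-- In the stable category, the first projection of a biproduct is an isomorphism when the second
factor is projective. -/
@[simps]
noncomputable def stabFstIso (Y : K) {I : K} (hI : proj (FSplit F) I) :
    (stab F).obj (Y ⊞ I) ≅ (stab F).obj Y where
  hom := (stab F).map biprod.fst
  inv := (stab F).map biprod.inl
  hom_inv_id := by
    rw [← (stab F).map_comp, ← (stab F).map_id, stab_map_eq_iff]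
    exact ⟨I, biprod.snd, -biprod.inr, hI, by rw [← biprod.total, comp_neg]; abel⟩
  inv_hom_id := by rw [← (stab F).map_comp, biprod.inl_fst, (stab F).map_id]

section

variable [HasShift (StableCategory (FSplit F)) ℤ] {σ : SuspensionIso (FSplit F)}
  (hE : IsFrobeniusClass (FSplit F))
include hE

/-- The image of an `F`-split triangle in the stable category. -/
lemma isStableTriangle_of_FSplit {X I X' : K} {i : X ⟶ I} {p : I ⟶ X'}
    {α : X' ⟶ X⟦(1 : ℤ)⟧} (hT : IsPreenvelopeTriangle (FSplit F) (Triangle.mk i p α)) {Y Z : K}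
    {a : X ⟶ Y} {b : Y ⟶ Z} {e : Z ⟶ X⟦(1 : ℤ)⟧} (hd : Triangle.mk a b e ∈ distTriang K)
    {n : Z ⟶ X'} (hn : n ≫ α = e) :
    IsStableTriangle σ (Triangle.mk ((stab F).map a) ((stab F).map b)
      (-((stab F).map n ≫ (suspIso σ hT).hom))) := by
  obtain ⟨Z₀, g₀, u₀, d, hp⟩ := exists_homotopyPushout a i
  obtain ⟨h, hu, hh, rfl⟩ := exists_cofibre_of_homotopyPushout hp hT.dist
  -- The pushout read the other way: `h'` is the cofibre map of `u₀ : I ⟶ Z₀`, and its third map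
  -- vanishes since `e` is phantom. So `h'` is a stable isomorphism from the standard cone to `Z`.
  obtain ⟨h', hg', hh', hd'⟩ := exists_cofibre_of_homotopyPushout (homotopyPushout_swap hp) hd
  have e₀ : e ≫ i⟦(1 : ℤ)⟧' = 0 := phantom_comp_inj
    (by rw [← hn, F.map_comp, hT.phantom, comp_zero]) hT.inj_obj₂ i
  have := isIso_stab_map hh' e₀ (by rw [hE.proj_eq_inj]; exact hT.inj_obj₂)
  -- The connecting map of the pushout is `-(h ≫ α)`, while swapping the two legs makes it `h' ≫ e`;
  -- this is the source of the sign in the statement.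
  have key : (stab F).map h = -((stab F).map h' ≫ (stab F).map n) := by
    rw [← Functor.map_comp, ← Functor.map_neg]
    exact hT.stab_map_eq hE.proj_eq_inj (by rw [neg_comp, assoc, hn, ← hd', neg_neg])
  refine (isStableTriangle_stableTriangle hT hh).of_iso
    (triangleIsoOfIso₃ (asIso ((stab F).map h')) ?_ ?_).symm
  · rw [asIso_hom, ← Functor.map_comp, hg']
  · rw [key, asIso_hom, neg_comp, comp_neg, assoc]

/-- The standard cone `Q` of `g` is a homotopy pushout along a preenvelope of `Y`. Its other cofibre
sequence `J ⟶ Q ⟶ X'` splits, so `Q` is stably `X'`; comparing the two connecting maps yields the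
minus sign. -/
lemma isStableTriangle_rotate_stableTriangle {X I X' : K} {i : X ⟶ I} {p : I ⟶ X'}
    {α : X' ⟶ X⟦(1 : ℤ)⟧} (hT : IsPreenvelopeTriangle (FSplit F) (Triangle.mk i p α)) {Y Z : K}
    {f : X ⟶ Y} {g : Y ⟶ Z} {h : Z ⟶ X'}
    (hd : Triangle.mk g h (α ≫ f⟦(1 : ℤ)⟧') ∈ distTriang K) :
    IsStableTriangle σ (Triangle.mk ((stab F).map g) ((stab F).map h ≫ (suspIso σ hT).hom)
      (-((stab F).map f)⟦(1 : ℤ)⟧')) := by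
  obtain ⟨Y', β, J, j, q, hT'⟩ := exists_preenvelope hE.enoughInj Y
  obtain ⟨Q, s, u, d, hp⟩ := exists_homotopyPushout g j
  obtain ⟨t, hu, ht, rfl⟩ := exists_cofibre_of_homotopyPushout hp hT'.dist
  obtain ⟨ψ, hs, hψ, hd'⟩ := exists_cofibre_of_homotopyPushout (homotopyPushout_swap hp) hd
  have e₀ : (α ≫ f⟦(1 : ℤ)⟧') ≫ j⟦(1 : ℤ)⟧' = 0 := phantom_comp_inj
    (by rw [F.map_comp, hT.phantom, zero_comp]) hT'.inj_obj₂ j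
  have := isIso_stab_map hψ e₀ (by rw [hE.proj_eq_inj]; exact hT'.inj_obj₂)
  obtain ⟨c, hc⟩ := hT.exists_map hT' f
  have key : (stab F).map t = -((stab F).map ψ ≫ (stab F).map c) := by
    rw [← Functor.map_comp, ← Functor.map_neg]
    exact hT'.stab_map_eq hE.proj_eq_inj (by rw [neg_comp, assoc, hc, ← hd', neg_neg])
  refine (isStableTriangle_stableTriangle hT' ht).of_iso
    (triangleIsoOfIso₃ (asIso ((stab F).map ψ) ≪≫ suspIso σ hT) ?_ ?_).symm
  · rw [Iso.trans_hom, asIso_hom, ← assoc, ← Functor.map_comp, hs]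
  · rw [key, Iso.trans_hom, asIso_hom, neg_comp, comp_neg, assoc, assoc,
      suspIso_naturality σ hT hT' f c hc]

lemma isStableTriangle_rotate {D : Triangle (StableCategory (FSplit F))}
    (hD : IsStableTriangle σ D) : IsStableTriangle σ D.rotate := by
  obtain ⟨X, I, X', i, p, α, hT, Y, Z, f, g, h, hd, ⟨e⟩⟩ := hD
  exact (isStableTriangle_rotate_stableTriangle hE hT hd).of_iso
    ((Pretriangulated.rotate (StableCategory (FSplit F))).mapIso e)

variable [(shiftFunctor (StableCategory (FSplit F)) (1 : ℤ)).Additive]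

/-- With `Z` written as the suspension of `Z'` by a projective cover, the phantom `h ≫ α` becomes `ζ
≫ k⟦1⟧'` for some `k : Z' ⟶ X`. The homotopy cartesian triangle is then, up to sign, the stable
triangle on `k`, with middle term `Y ⊞ I` stably equal to `Y`. -/
lemma exists_iso_rotate_stableTriangle {X I X' : K} {i : X ⟶ I} {p : I ⟶ X'}
    {α : X' ⟶ X⟦(1 : ℤ)⟧} (hT : IsPreenvelopeTriangle (FSplit F) (Triangle.mk i p α)) {Y Z : K}
    {f : X ⟶ Y} {g : Y ⟶ Z} {u : I ⟶ Z} {h : Z ⟶ X'}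
    (hp : Triangle.mk (biprod.lift f i) (biprod.desc g (-u)) (-(h ≫ α)) ∈ distTriang K) :
    ∃ D : Triangle (StableCategory (FSplit F)), IsStableTriangle σ D ∧
      Nonempty (D.rotate ≅ stableTriangle σ hT f g h) := by
  obtain ⟨Z', P, r, s, ζ, hT'⟩ := exists_projective_preenvelope hE Z
  have hP : proj (FSplit F) P := by rw [hE.proj_eq_inj]; exact hT'.inj_obj₂
  have hI : proj (FSplit F) I := by rw [hE.proj_eq_inj]; exact hT.inj_obj₂
  obtain ⟨k', hk'⟩ := exists_desc₃ hT'.dist (h ≫ α)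
    (proj_comp_phantom (by rw [F.map_comp, hT.phantom, comp_zero]) hP s)
  obtain ⟨k, rfl⟩ := (shiftFunctor K (1 : ℤ)).map_surjective k'
  have hp' : Triangle.mk (biprod.lift f i) (-(biprod.desc g (-u))) (ζ ≫ k⟦(1 : ℤ)⟧') ∈
      distTriang K :=
    distinguished_of_iso hp (Iso.refl _) (Iso.refl _) (-Iso.refl _) (by simp) (by simp)
      (by simp [hk'])
  have hz : (stab F).map u = 0 := (isZero_stab_obj hI).eq_of_src _ _
  have hw := suspIso_naturality σ hT' hT k h hk'
  have e₁ : (stab F).map (biprod.lift f i) ≫ (stab F).map biprod.fst = (stab F).map f := by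
    rw [← Functor.map_comp, biprod.lift_fst]
  have e₂ : (stab F).map (biprod.desc g (-u)) = (stab F).map biprod.fst ≫ (stab F).map g := by
    rw [biprod.desc_eq, Functor.map_add, Functor.map_comp, Functor.map_comp, Functor.map_neg, hz,
      neg_zero, comp_zero, add_zero]
  refine ⟨_, isStableTriangle_stableTriangle hT' hp',
    ⟨triangleIso (Iso.refl _) (stabFstIso Y hI)
      (-(suspIso σ hT').symm)
      ?_ ?_ ?_⟩⟩
  · exact e₁.trans (id_comp _).symm
  · have e₃ : ((stab F).map (-(biprod.desc g (-u))) ≫ (suspIso σ hT').hom) ≫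
        (-(suspIso σ hT').inv) = (stab F).map biprod.fst ≫ (stab F).map g := by
      rw [comp_neg, assoc, Iso.hom_inv_id, comp_id, Functor.map_neg, neg_neg, e₂]
    exact e₃
  · have e₃ : (-((stab F).map k)⟦(1 : ℤ)⟧') ≫ (𝟙 ((stab F).obj X))⟦(1 : ℤ)⟧' =
        (-(suspIso σ hT').inv) ≫ (stab F).map h ≫ (suspIso σ hT).hom := by
      rw [hw, neg_comp, neg_comp, Iso.inv_hom_id_assoc, CategoryTheory.Functor.map_id, comp_id]
    exact e₃

lemma isStableTriangle_of_rotate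
    [∀ n : ℤ, (shiftFunctor (StableCategory (FSplit F)) n).Additive]
    {D : Triangle (StableCategory (FSplit F))} (hD : IsStableTriangle σ D.rotate) :
    IsStableTriangle σ D := by
  obtain ⟨X, I, X', i, p, α, hT, Y, Z, f, g, u, h, hp, -, -, ⟨e⟩⟩ := hD.exists_pushout
  obtain ⟨D', hD', ⟨e'⟩⟩ := exists_iso_rotate_stableTriangle (σ := σ) hE hT hp
  have e'' : (Pretriangulated.rotate (StableCategory (FSplit F))).obj D ≅
    (Pretriangulated.rotate (StableCategory (FSplit F))).obj D' := e ≪≫ e'.symm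
  -- Rotation is fully faithful on triangles, so an isomorphism of rotated triangles comes from one
  -- of the triangles themselves.
  exact hD'.of_iso ((Pretriangulated.rotate (StableCategory (FSplit F))).preimageIso e'')

/-- The octahedral axiom may be checked after replacing a composable pair by an isomorphic one, here
a pair of `F`-split monomorphisms. Their composite is again one, and so is `m₁` in the octahedron of
`K`, whose third map `w₂₃ ≫ v₁₂⟦1⟧'` is phantom. -/
lemma exists_octahedron_stable {X Y W : K} (f : X ⟶ Y) (k : Y ⟶ W) :
    ∃ (X₂ X₃ Z₁₂ Z₂₃ Z₁₃ : StableCategory (FSplit F)) (u₁₂ : (stab F).obj X ⟶ X₂)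
      (u₂₃ : X₂ ⟶ X₃) (e₂ : (stab F).obj Y ≅ X₂) (e₃ : (stab F).obj W ≅ X₃)
      (_ : (stab F).map f ≫ e₂.hom = u₁₂) (_ : (stab F).map k ≫ e₃.hom = e₂.hom ≫ u₂₃)
      (v₁₂ : X₂ ⟶ Z₁₂) (w₁₂ : Z₁₂ ⟶ ((stab F).obj X)⟦(1 : ℤ)⟧)
      (_ : IsStableTriangle σ (Triangle.mk u₁₂ v₁₂ w₁₂))
      (v₂₃ : X₃ ⟶ Z₂₃) (w₂₃ : Z₂₃ ⟶ X₂⟦(1 : ℤ)⟧)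
      (_ : IsStableTriangle σ (Triangle.mk u₂₃ v₂₃ w₂₃))
      (v₁₃ : X₃ ⟶ Z₁₃) (w₁₃ : Z₁₃ ⟶ ((stab F).obj X)⟦(1 : ℤ)⟧)
      (_ : IsStableTriangle σ (Triangle.mk (u₁₂ ≫ u₂₃) v₁₃ w₁₃))
      (m₁ : Z₁₂ ⟶ Z₁₃) (m₃ : Z₁₃ ⟶ Z₂₃), v₁₂ ≫ m₁ = u₂₃ ≫ v₁₃ ∧ m₁ ≫ w₁₃ = w₁₂ ∧
        v₁₃ ≫ m₃ = v₂₃ ∧ w₁₃ ≫ u₁₂⟦(1 : ℤ)⟧' = m₃ ≫ w₂₃ ∧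
        IsStableTriangle σ (Triangle.mk m₁ m₃ (w₂₃ ≫ v₁₂⟦(1 : ℤ)⟧')) := by
  obtain ⟨X', α, I, i, p, hT⟩ := exists_preenvelope hE.enoughInj X
  obtain ⟨Y', β, J, j, q, hT₂⟩ := exists_preenvelope hE.enoughInj (Y ⊞ I)
  have hI : proj (FSplit F) I := by rw [hE.proj_eq_inj]; exact hT.inj_obj₂
  have hJ : proj (FSplit F) J := by rw [hE.proj_eq_inj]; exact hT₂.inj_obj₂
  obtain ⟨a, ha⟩ : ∃ a : X ⟶ Y ⊞ I, a = biprod.lift f i := ⟨_, rfl⟩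
  obtain ⟨b, hb⟩ : ∃ b : Y ⊞ I ⟶ W ⊞ J, b = biprod.lift (biprod.fst ≫ k) j := ⟨_, rfl⟩
  have ma : Mono (F.map a) := by
    have : Mono (F.map i) := (map_mor₃_eq_zero_iff_mono hT.dist).1 hT.phantom
    have h : F.map a ≫ F.map biprod.snd = F.map i := by
      rw [← F.map_comp, ha, biprod.lift_snd]
    exact mono_of_mono_fac h
  have mb : Mono (F.map b) := by
    have : Mono (F.map j) := (map_mor₃_eq_zero_iff_mono hT₂.dist).1 hT₂.phantom
    have h : F.map b ≫ F.map biprod.snd = F.map j := by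
      rw [← F.map_comp, hb, biprod.lift_snd]
    exact mono_of_mono_fac h
  have mab : Mono (F.map (a ≫ b)) := by rw [F.map_comp]; infer_instance
  obtain ⟨Z₁₂, v₁₂, w₁₂, h₁₂, p₁₂⟩ := (isEMono_FSplit_iff a).2 ma
  obtain ⟨Z₂₃, v₂₃, w₂₃, h₂₃, p₂₃⟩ := (isEMono_FSplit_iff b).2 mb
  obtain ⟨Z₁₃, v₁₃, w₁₃, h₁₃, p₁₃⟩ := (isEMono_FSplit_iff (a ≫ b)).2 mab
  obtain ⟨Z', γ, _, _, _, hT₃⟩ := exists_preenvelope hE.enoughInj Z₁₂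
  obtain ⟨m₁, m₃, c₁, c₂, c₃, c₄, hm⟩ := exists_octahedron rfl h₁₂ h₂₃ h₁₃
  obtain ⟨n₁₂, e₁₂⟩ := hT.exists_lift (h := w₁₂) p₁₂
  obtain ⟨n₁₃, e₁₃⟩ := hT.exists_lift (h := w₁₃) p₁₃
  obtain ⟨n₂₃, e₂₃⟩ := hT₂.exists_lift (h := w₂₃) p₂₃
  obtain ⟨c, hc⟩ := hT.exists_map hT₂ a
  obtain ⟨c', hc'⟩ := hT₂.exists_map hT₃ v₁₂
  have s₁₃ := isStableTriangle_of_FSplit (σ := σ) hE hT h₁₃ e₁₃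
  rw [Functor.map_comp] at s₁₃
  have sm := isStableTriangle_of_FSplit (σ := σ) hE hT₃ hm (n := n₂₃ ≫ c')
    (by rw [assoc, hc', reassoc_of% e₂₃])
  -- Identities between the lifts `n₁₂`, `n₁₃`, `n₂₃` hold stably because they hold after composing
  -- with the universal phantoms, where they are the octahedral identities of `K`.
  have k₁ : (stab F).map (m₁ ≫ n₁₃) = (stab F).map n₁₂ :=
    hT.stab_map_eq hE.proj_eq_inj (by rw [assoc, e₁₃, c₂, e₁₂])
  have k₂ : (stab F).map (n₁₃ ≫ c) = (stab F).map (m₃ ≫ n₂₃) :=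
    hT₂.stab_map_eq hE.proj_eq_inj (by rw [assoc, assoc, hc, e₂₃, reassoc_of% e₁₃, c₄])
  rw [Functor.map_comp, Functor.map_comp] at k₂
  have l₁ := suspIso_naturality σ hT hT₂ a c hc
  have l₂ := suspIso_naturality σ hT₂ hT₃ v₁₂ c' hc'
  rw [Functor.map_comp, assoc, l₂, ← assoc, ← neg_comp] at sm
  refine ⟨_, _, _, _, _, (stab F).map a, (stab F).map b, (stabFstIso Y hI).symm,
    (stabFstIso W hJ).symm, ?_, ?_, _, _, isStableTriangle_of_FSplit hE hT h₁₂ e₁₂, _, _,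
    isStableTriangle_of_FSplit hE hT₂ h₂₃ e₂₃, _, _, s₁₃, (stab F).map m₁, (stab F).map m₃,
    ?_, ?_, ?_, ?_, sm⟩
  · rw [Iso.symm_hom, Iso.comp_inv_eq, stabFstIso_hom, ← Functor.map_comp, ha, biprod.lift_fst]
  · rw [Iso.symm_hom, Iso.symm_hom, Iso.comp_inv_eq, stabFstIso_hom, stabFstIso_inv,
      ← Functor.map_comp, ← Functor.map_comp, hb, assoc, biprod.lift_fst, biprod.inl_fst_assoc]
  · rw [← Functor.map_comp, c₁, Functor.map_comp]
  · rw [comp_neg, ← assoc, ← Functor.map_comp, k₁]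
  · rw [← Functor.map_comp, c₃]
  · rw [neg_comp, comp_neg, assoc, ← l₁, reassoc_of% k₂]

/-- The triangulation of the stable category. -/
abbrev stablePretriangulated (σ : SuspensionIso (FSplit F))
    [∀ n : ℤ, (shiftFunctor (StableCategory (FSplit F)) n).Additive] :
    Pretriangulated (StableCategory (FSplit F)) where
  distinguishedTriangles := {D | IsStandardTriangle σ D}
  isomorphic_distinguished D hD D' e := by
    exact (isStandardTriangle_iff _).2 (((isStandardTriangle_iff D).1 hD).of_iso e)
  contractible_distinguished X :=
    (isStandardTriangle_iff _).2 (isStableTriangle_contractible hE X)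
  distinguished_cocone_triangle a := by
    obtain ⟨Z, b, c, hD⟩ := exists_isStableTriangle (σ := σ) hE a
    exact ⟨Z, b, c, (isStandardTriangle_iff _).2 hD⟩
  rotate_distinguished_triangle D := by
    exact (isStandardTriangle_iff D).trans ((Iff.intro (isStableTriangle_rotate hE)
      (isStableTriangle_of_rotate hE)).trans (isStandardTriangle_iff D.rotate).symm)
  complete_distinguished_triangle_morphism D₁ D₂ h₁ h₂ a b w :=
    exists_hom₃_of_isStableTriangle hE ((isStandardTriangle_iff _).1 h₁)
      ((isStandardTriangle_iff _).1 h₂) a b w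

lemma isTriangulated_stablePretriangulated (σ : SuspensionIso (FSplit F))
    [∀ n : ℤ, (shiftFunctor (StableCategory (FSplit F)) n).Additive] :
    letI := stablePretriangulated hE σ
    IsTriangulated (StableCategory (FSplit F)) := by
  let := stablePretriangulated hE σ
  refine IsTriangulated.mk' fun X Y W x y => ?_
  obtain ⟨f, rfl⟩ := (stab F).map_surjective (X := X.as) (Y := Y.as) x
  obtain ⟨k, rfl⟩ := (stab F).map_surjective (X := Y.as) (Y := W.as) y
  obtain ⟨X₂, X₃, Z₁₂, Z₂₃, Z₁₃, u₁₂, u₂₃, e₂, e₃, q₁, q₂, v₁₂, w₁₂, h₁₂, v₂₃, w₂₃, h₂₃, v₁₃, w₁₃,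
    h₁₃, m₁, m₃, c₁, c₂, c₃, c₄, hm⟩ := exists_octahedron_stable (σ := σ) hE f k
  exact ⟨_, X₂, X₃, Z₁₂, Z₂₃, Z₁₃, u₁₂, u₂₃, Iso.refl _, e₂, e₃, q₁.trans (id_comp _).symm, q₂,
    v₁₂, w₁₂, (isStandardTriangle_iff _).2 h₁₂, v₂₃, w₂₃, (isStandardTriangle_iff _).2 h₂₃,
    v₁₃, w₁₃, (isStandardTriangle_iff _).2 h₁₃,
    ⟨⟨m₁, m₃, c₁, c₂, c₃, c₄, (isStandardTriangle_iff _).2 hm⟩⟩⟩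

end

end Triangulation

end RelStable

theorem mainTheorem5
    {K : Type u} [Category.{v} K] [HasZeroObject K] [HasShift K ℤ] [Preadditive K]
    [∀ n : ℤ, (shiftFunctor K n).Additive] [Pretriangulated K] [IsTriangulated K]
    {L : Type u'} [Category.{v'} L] [HasZeroObject L] [HasShift L ℤ] [Preadditive L]
    [∀ n : ℤ, (shiftFunctor L n).Additive] [Pretriangulated L] [IsTriangulated L]
    (F : K ⥤ L) [F.CommShift ℤ] [F.IsTriangulated]
    (V U : L ⥤ K) (adjVF : V ⊣ F) (adjFU : F ⊣ U)
    (W : L ≌ L) (hW : Nonempty (W.functor ⋙ V ≅ U)) :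
    RelStable.proj (RelStable.FSplit F) = RelStable.inj (RelStable.FSplit F) ∧
    RelStable.proj (RelStable.FSplit F) = RelStable.addClosure U.essImage ∧
    RelStable.addClosure U.essImage = RelStable.addClosure V.essImage ∧
    RelStable.IsFrobeniusClass (RelStable.FSplit F) ∧
    ∃ (_ : HasShift (RelStable.StableCategory (RelStable.FSplit F)) ℤ)
      (_ : ∀ n : ℤ, (shiftFunctor (RelStable.StableCategory (RelStable.FSplit F)) n).Additive)
      (_ : Pretriangulated (RelStable.StableCategory (RelStable.FSplit F)))
      (σ : RelStable.SuspensionIso (RelStable.FSplit F)),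
      IsTriangulated (RelStable.StableCategory (RelStable.FSplit F)) ∧
      ∀ D : Triangle (RelStable.StableCategory (RelStable.FSplit F)),
        D ∈ distTriang (RelStable.StableCategory (RelStable.FSplit F)) ↔
          RelStable.IsStandardTriangle σ D := by 
  have h := RelStable.essImage_eq_of_equivalence W hW.some
  have hE := RelStable.isFrobeniusClass_FSplit adjVF adjFU h
  refine ⟨hE.proj_eq_inj, by rw [RelStable.proj_FSplit_eq adjVF, h], by rw [h], hE, ?_⟩
  -- The suspension is only an autoequivalence; its powers supply the shift by `ℤ`, and `θ`
  -- identifies the shift by one with it.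
  let := RelStable.hasShiftOfEquivalence (RelStable.suspension hE).asEquivalence
  let θ : shiftFunctor (RelStable.StableCategory (RelStable.FSplit F)) (1 : ℤ) ≅
      RelStable.suspension hE :=
    RelStable.shiftOfEquivalenceOneIso (RelStable.suspension hE).asEquivalence
  have : (shiftFunctor (RelStable.StableCategory (RelStable.FSplit F)) (1 : ℤ)).Additive :=
    Functor.additive_of_iso θ.symm
  have : ∀ n : ℤ, (shiftFunctor (RelStable.StableCategory (RelStable.FSplit F)) n).Additive :=
    RelStable.additive_shiftFunctor_of_one
  exact ⟨inferInstance, inferInstance,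
    RelStable.stablePretriangulated hE (RelStable.suspensionIsoOfIso hE θ),
    RelStable.suspensionIsoOfIso hE θ,
    RelStable.isTriangulated_stablePretriangulated hE (RelStable.suspensionIsoOfIso hE θ),
    fun _ => Iff.rfl⟩
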